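/- **The game.** Fix an integer $k\ge 2$. A simple weighted tree is a finite rooted tree $T$ with root $r$ in which every vertex $u\neq r$ has a parent $p(u)$ and an edge $(u,p(u))$ of length $d_u>0$, and no vertex other than possibly the root has degree $2$. A configuration $x\in\mathcal X(T)$ places $k$ robots on the leaves of $T$ (a lone root counts as a leaf); for robots located at vertices of $T$, $x_u$ denotes the number of robots at descendants of $u$ (including $u$), and $\mathrm{OT}_T(x,x')=\sum_{u\ne r}d_u|x_u-x'_u|$. In the continuous tree-mining game the state is a simple weighted tree $T$ with a configuration $x$; initially $T$ has a single leaf (it is the lone root or a single edge), which holds all $k$ robots, and the cost is $0$. The adversary may - elongate continuously, at unit rate, the edge leading to a leaf $\ell\neq r$ with $x_\ell\ge 2$; the player pays at rate $x_\ell$ and may re-allocate robots at any instant $t$, paying $\mathrm{OT}_{T(t)}(x,x')$; - fork a leaf $\ell$ with $x_\ell\ge3$ into $m\in\{2,\dots,x_\ell-1\}$ new children, at a distance $\delta\in(0,1)$ from $\ell$ that is chosen by the player; the player must assign the $x_\ell$ robots to the new leaves and pays $\mathrm{OT}_{T'}(x,x')$, where $T'$ is the new tree; - kill a leaf $\ell$,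 provided that another leaf exists: $\ell$ and its edge are removed, and if $p(\ell)\ne r$ is left with only one child $u$, then $p(\ell)$ is suppressed and $u$ is joined to $p(p(\ell))$ by an edge of length $d_{p(\ell)}+d_u$; the player must move to a configuration $x'$ on the new tree and pays $\mathrm{OT}_T(x,x')$, where $T$ is the tree before the kill. A strategy consists of a function $\mathcal A(T,x,T')\in\mathcal X(T')$, giving the new configuration when the tree becomes $T'$ (with $T'=T$ at the instants of an elongation), and of a choice of the fork lengths $\delta$. Given $f(\cdot,\cdot)$, the strategy is $f(k,D)$-bounded if it obeys these rules, does not stall the game (during an elongation the player's moves occur at well-defined instants and do not accumulate) and, however the adversary plays, the accumulated cost is at all times at most $f(k,D)$, where $D$ is the current depth of the highest leaf (the least distance from the root to a leaf). **Theorem.** There are a function $f$ and a constant $C$ with $|f(k,D)|\le C\,k^2D$ for all integers $k\ge2$ and real $D\ge0$, such that for every $k\ge 2$ there is an $f(k,D)$-bounded strategy of the player in the continuous tree-mining game with $k$ robots. Moreover, the strategy can be taken to be a greedy rule $$\mathcal A(T,x,T')\in\operatorname*{argmin}_{x'\in\mathcal X(T')}\ \Psi(T',x')+\mathrm{OT}(x,x'),\qquad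 \Psi(T,x)=\sum_{u\neq r}d_u\,\phi(x_u),\qquad \phi(y)=20ky+5y^2,$$ where $\mathrm{OT}$ is taken in $T'$ if $T'=T$ or $T'$ arises by a fork, and in $T$ if $T'$ arises by a kill, and where for $T'=T$ ties are broken in favor of $x'\ne x$. -/

import Mathlib

namespace CTM

/-- Data of a finite rooted weighted tree. The vertices are natural numbers and the root is `0`;
`parent u` and `len u` are the parent of `u` and the length `d_u` of the edge `(u, parent u)`. -/
@[ext]
structure WTree where
  verts : Finset ℕ
  parent : ℕ → ℕ
  len : ℕ → ℝ

namespace WTree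

/-- The children of a vertex. -/
def children (T : WTree) (u : ℕ) : Finset ℕ :=
  (T.verts.erase 0).filter fun v => T.parent v = u

/-- The leaves: the vertices without children (so a lone root is a leaf). -/
def leaves (T : WTree) : Finset ℕ :=
  T.verts.filter fun u => T.children u = ∅

/-- `v ⪯ u`: the vertex `u` is obtained from `v` by iterating the parent map. -/
def Desc (T : WTree) (v u : ℕ) : Prop :=
  ∃ n : ℕ, T.parent^[n] v = u

/-- `T` is a simple weighted tree: every vertex is joined to the root `0` by its chain of parents,
edges have positive length, and no vertex other than the root has degree two (that is, exactly one
child). The last three fields only fix the values of `parent` and `len` where they carry no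
information. -/
structure IsSimpleTree (T : WTree) : Prop where
  root_mem : 0 ∈ T.verts
  parent_mem : ∀ u ∈ T.verts, T.parent u ∈ T.verts
  desc_root : ∀ u ∈ T.verts, T.Desc u 0
  len_pos : ∀ u ∈ T.verts, u ≠ 0 → 0 < T.len u
  simple : ∀ u ∈ T.verts, u ≠ 0 → (T.children u).card ≠ 1
  parent_root : T.parent 0 = 0
  len_root : T.len 0 = 0
  off_verts : ∀ u ∉ T.verts, T.parent u = u ∧ T.len u = 0

open Classical in
/-- The number `x_u` of robots located at the descendants of `u` (including `u`). -/
noncomputable def mass (T : WTree) (x : ℕ → ℕ) (u : ℕ) : ℕ :=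
  ∑ v ∈ T.verts with T.Desc v u, x v

open Classical in
/-- The distance from a vertex to the root. -/
noncomputable def depth (T : WTree) (v : ℕ) : ℝ :=
  ∑ u ∈ (T.verts.erase 0) with T.Desc v u, T.len u

/-- The depth of the highest leaf, i.e. of the leaf that is closest to the root. -/
noncomputable def highestLeafDepth (T : WTree) : ℝ :=
  sInf (T.depth '' (T.leaves : Set ℕ))

/-- The discrete configurations of `k` robots on the leaves of `T`. -/
def configs (T : WTree) (k : ℕ) : Set (ℕ → ℕ) :=
  {x | (∀ u ∉ T.leaves, x u = 0) ∧ ∑ u ∈ T.leaves, x u = k}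

/-- The optimal transport cost `∑_u d_u |x_u - x'_u|` on `T`, for robots located at vertices
of `T`. -/
noncomputable def OT (T : WTree) (x x' : ℕ → ℕ) : ℝ :=
  ∑ u ∈ T.verts.erase 0, T.len u * |(T.mass x u : ℝ) - (T.mass x' u : ℝ)|

/-- The potential `Ψ(T, x) = ∑_{u ≠ r} d_u φ(x_u)`. -/
noncomputable def potential (T : WTree) (φ : ℝ → ℝ) (x : ℕ → ℕ) : ℝ :=
  ∑ u ∈ T.verts.erase 0, T.len u * φ (T.mass x u)

/-- The edge leading to `l` becomes longer by `s`. -/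
noncomputable def elongate (T : WTree) (l : ℕ) (s : ℝ) : WTree where
  verts := T.verts
  parent := T.parent
  len := Function.update T.len l (T.len l + s)

/-- The leaf `l` receives the new vertices in `S` as children, by edges of length `δ`. -/
noncomputable def fork (T : WTree) (l : ℕ) (S : Finset ℕ) (δ : ℝ) : WTree where
  verts := T.verts ∪ S
  parent := fun v => if v ∈ S then l else T.parent v
  len := fun v => if v ∈ S then δ else T.len v

/-- The siblings of a vertex. -/
def siblings (T : WTree) (l : ℕ) : Finset ℕ :=
  (T.children (T.parent l)).erase l

/-- The leaf `l` and its edge are removed. If its parent `p` is not the root and is left with only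
one child `u`, then `p` is suppressed and `u` is attached to the parent of `p` by an edge of length
`d_p + d_u`. -/
noncomputable def kill (T : WTree) (l : ℕ) : WTree :=
  let p := T.parent l
  if p ≠ 0 ∧ (T.siblings l).card = 1 then
    { verts := (T.verts.erase l).erase p
      parent := fun v =>
        if v = l ∨ v = p then v else if v ∈ T.siblings l then T.parent p else T.parent v
      len := fun v =>
        if v = l ∨ v = p then 0 else if v ∈ T.siblings l then T.len p + T.len v else T.len v }
  else
    { verts := T.verts.erase l
      parent := fun v => if v = l then v else T.parent v
      len := fun v => if v = l then 0 else T.len v }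

/-- The adversary may elongate `l`: it is a leaf with an edge and at least two robots. -/
def CanElongate (T : WTree) (x : ℕ → ℕ) (l : ℕ) : Prop :=
  l ∈ T.leaves ∧ l ≠ 0 ∧ 2 ≤ x l

/-- The adversary may fork `l`, with the elements of `S` as new leaves: the number `m` of new leaves
satisfies `2 ≤ m ≤ x_l - 1`. -/
def CanFork (T : WTree) (x : ℕ → ℕ) (l : ℕ) (S : Finset ℕ) : Prop :=
  l ∈ T.leaves ∧ Disjoint S T.verts ∧ 2 ≤ S.card ∧ S.card + 1 ≤ x l

/-- The adversary may kill `l`: it is a leaf, and some other leaf stays alive. -/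
def CanKill (T : WTree) (l : ℕ) : Prop :=
  l ∈ T.leaves ∧ ∃ l' ∈ T.leaves, l' ≠ l

end WTree

/-- A strategy of the player with `k` robots. `move T x T'` is the new configuration on the modified
tree `T'`, given the previous tree `T` and configuration `x`; it is used with `T' = T` while a leaf
is elongated. `forkLength T x l m` is the length of the new edges that the player chooses when the
leaf `l` is forked into `m` children. -/
structure Strategy (k : ℕ) where
  move : WTree → (ℕ → ℕ) → WTree → (ℕ → ℕ)
  forkLength : WTree → (ℕ → ℕ) → ℕ → ℕ → ℝ
  move_mem : ∀ T x T', T.IsSimpleTree → x ∈ T.configs k → T'.IsSimpleTree →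
    move T x T' ∈ T'.configs k
  forkLength_pos : ∀ T x l m, 0 < forkLength T x l m
  forkLength_lt_one : ∀ T x l m, forkLength T x l m < 1

namespace Strategy

variable {k : ℕ}

/-- The answer of the player at an instant at which the tree is `T`. -/
def respond (A : Strategy k) (T : WTree) (x : ℕ → ℕ) : ℕ → ℕ :=
  A.move T x T

/-- In configuration `x` the player moves no robot while the leaf `l` of `T` is being elongated by
`s`, before the end of that elongation. -/
def QuietUntil (A : Strategy k) (T : WTree) (x : ℕ → ℕ) (l : ℕ) (s : ℝ) : Prop :=
  ∀ t : ℝ, 0 ≤ t → t < s → A.respond (T.elongate l t) x = x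

/-- The tree after a fork, with the length chosen by the player. -/
noncomputable def forkTree (A : Strategy k) (T : WTree) (x : ℕ → ℕ) (l : ℕ) (S : Finset ℕ) :
    WTree :=
  T.fork l S (A.forkLength T x l S.card)

/-- `A.Reach T x c`: against the strategy `A`, the adversary can bring the game to the tree `T` with
configuration `x` and accumulated cost `c`. The game starts with all robots on the only leaf of a
simple weighted tree (a lone root or a single edge) and cost `0`. An elongation is cut into pieces
during which no robot moves; the player reacts at the end of each piece. -/
inductive Reach (A : Strategy k) : WTree → (ℕ → ℕ) → ℝ → Prop
  | start (T : WTree) (l : ℕ) : T.IsSimpleTree → T.leaves = {l} → Reach A T (Pi.single l k) 0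
  | wait (T : WTree) (x : ℕ → ℕ) (c : ℝ) : Reach A T x c →
      Reach A T (A.respond T x) (c + T.OT x (A.respond T x))
  | elongate (T : WTree) (x : ℕ → ℕ) (c : ℝ) (l : ℕ) (s : ℝ) : Reach A T x c →
      T.CanElongate x l → 0 < s → A.QuietUntil T x l s →
      Reach A (T.elongate l s) (A.respond (T.elongate l s) x)
        (c + s * x l + (T.elongate l s).OT x (A.respond (T.elongate l s) x))
  | fork (T : WTree) (x : ℕ → ℕ) (c : ℝ) (l : ℕ) (S : Finset ℕ) : Reach A T x c →
      T.CanFork x l S →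
      Reach A (A.forkTree T x l S) (A.move T x (A.forkTree T x l S))
        (c + (A.forkTree T x l S).OT x (A.move T x (A.forkTree T x l S)))
  | kill (T : WTree) (x : ℕ → ℕ) (c : ℝ) (l : ℕ) : Reach A T x c →
      T.CanKill l →
      Reach A (T.kill l) (A.move T x (T.kill l)) (c + T.OT x (A.move T x (T.kill l)))

/-- `A.Sustains l T x r`: from the tree `T` with configuration `x`, an adversary who keeps elongating
the leaf `l` for a total duration `r` is only stopped, after finitely many moves of the player,
because the duration has elapsed or because `l` has at most one robot. -/
inductive Sustains (A : Strategy k) (l : ℕ) : WTree → (ℕ → ℕ) → ℝ → Prop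
  | done (T : WTree) (x : ℕ → ℕ) : Sustains A l T x 0
  | blocked (T : WTree) (x : ℕ → ℕ) (r : ℝ) : x l ≤ 1 → Sustains A l T x r
  | wait (T : WTree) (x : ℕ → ℕ) (r : ℝ) : Sustains A l T (A.respond T x) r → Sustains A l T x r
  | elongate (T : WTree) (x : ℕ → ℕ) (r s : ℝ) : 2 ≤ x l → 0 < s → s ≤ r →
      A.QuietUntil T x l s →
      Sustains A l (T.elongate l s) (A.respond (T.elongate l s) x) (r - s) → Sustains A l T x r

/-- The strategy obeys the rules in every state that can occur: at a fork it sends the robots of the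
forked leaf to the new leaves, and it never stalls time (its moves during an elongation occur at well
defined instants and do not accumulate). -/
structure IsLegal (A : Strategy k) : Prop where
  fork_keeps : ∀ (T : WTree) (x : ℕ → ℕ) (c : ℝ) (l : ℕ) (S : Finset ℕ), A.Reach T x c → T.CanFork x l S →
    ∀ u ∈ T.leaves, u ≠ l → A.move T x (A.forkTree T x l S) u = x u
  sustains : ∀ (T : WTree) (x : ℕ → ℕ) (c : ℝ) (l : ℕ) (r : ℝ), A.Reach T x c → T.CanElongate x l → 0 < r → A.Sustains l T x r

/-- The strategy is `f(k, D)`-bounded: however the adversary plays, the cost is at all times at most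
`f(k, D)`, where `D` is the current depth of the highest leaf. -/
def IsBounded (A : Strategy k) (f : ℕ → ℝ → ℝ) : Prop :=
  A.IsLegal ∧ ∀ T x c, A.Reach T x c → c ≤ f k T.highestLeafDepth

/-- The strategy is the greedy rule `argmin_{x'} Ψ(T', x') + OT(x, x')`, the minimum being over all
configurations `x'` on the modified tree `T'`, with ties broken in favor of `x' ≠ x`. The transport
takes place in `T` if a leaf of `T` is killed, and in `T'` if a leaf is forked. -/
structure IsGreedy (A : Strategy k) (φ : ℝ → ℝ) : Prop where
  stay : ∀ (T : WTree) (x : ℕ → ℕ), T.IsSimpleTree → x ∈ T.configs k → ∀ z ∈ T.configs k,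
    T.potential φ (A.respond T x) + T.OT x (A.respond T x) ≤ T.potential φ z + T.OT x z
  ties : ∀ (T : WTree) (x : ℕ → ℕ), T.IsSimpleTree → x ∈ T.configs k → A.respond T x = x →
    ∀ z ∈ T.configs k, z ≠ x → T.potential φ x < T.potential φ z + T.OT x z
  fork : ∀ (T : WTree) (x : ℕ → ℕ) (l : ℕ) (S : Finset ℕ) (δ : ℝ), T.IsSimpleTree →
    x ∈ T.configs k → T.CanFork x l S → 0 < δ → δ ≤ 1 →
    ∀ z ∈ (T.fork l S δ).configs k,
      (T.fork l S δ).potential φ (A.move T x (T.fork l S δ))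
          + (T.fork l S δ).OT x (A.move T x (T.fork l S δ)) ≤
        (T.fork l S δ).potential φ z + (T.fork l S δ).OT x z
  kill : ∀ (T : WTree) (x : ℕ → ℕ) (l : ℕ), T.IsSimpleTree → x ∈ T.configs k → T.CanKill l →
    ∀ z ∈ (T.kill l).configs k,
      (T.kill l).potential φ (A.move T x (T.kill l)) + T.OT x (A.move T x (T.kill l)) ≤
        (T.kill l).potential φ z + T.OT x z

end Strategy

end CTM

/-! The proof maintains `c + Ψ(T, x) ≤ 21 Ψ(T, z)` for all configurations `z`. Testing it with all
robots on the highest leaf, where `Ψ = φ(k) D = 25 k² D`, gives `c ≤ 525 k² D`. Two further facts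
are carried along (`Invariant`): `x` is strictly stable, so that every transport away from it costs
more than it saves, and every leaf attracts, so that a configuration leaving it empty gains,
transport included, by sending a robot there.

The local tool compares opposite moves. If `w` has more robots than `y` on a leaf `l`, there is a
path from `l` to a leaf `f` along which the surplus of `w` persists going up and is a deficit going
down (`exists_exchange`). The increments of `φ` grow by 10 per robot, so this convexity offsets the
unit transport costs: sending a robot of `w` from `l` to `f` costs at most what `y` gains from the
opposite move, up to an error proportional to lengths (`moveCost_le`). The linear term `20 k y`
keeps the relevant increments between `20 k` and `30 k`; hence the descent to `f` is at most 3/2 of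
the ascent, up to a fraction of the gain (`upLen_le_of_gain_le`). With a surplus of two, a stable
`x` forces `y` to gain (`exists_gain`), and a robot of `w` leaves `l` for little more than the gain
of `y` (`exists_cheap_move_of_gap`).

Elongation: a minimizer of the new potential has at least `x l - 1 ≥ 1` robots on `l`, so the
minimum grows at a rate comparable to the player's expense. Fork: the new edges are so short that
only the robots of the forked leaf move; at most `x l - 1` new leaves share them, and pigeonhole
makes the new leaves attract. Kill: the robots leave `l` one by one, the costs being charged to the
differences of the minima of `Ψ` under the constraint of at most `n` robots on `l`. For the last
robot the surplus is only one, and attraction bounds the distance it has to travel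
(`exists_cheap_last_move`, `exists_evacuation`). -/

namespace CTM

/-! ### Descendants, masses and exchange paths -/

namespace WTree

variable {T : WTree} {k : ℕ}

theorem mem_children {u c : ℕ} : c ∈ T.children u ↔ c ≠ 0 ∧ c ∈ T.verts ∧ T.parent c = u := by
  simp [children, and_assoc]

theorem mem_leaves {u : ℕ} : u ∈ T.leaves ↔ u ∈ T.verts ∧ T.children u = ∅ := by
  simp [leaves]

theorem Desc.refl (T : WTree) (v : ℕ) : T.Desc v v := ⟨0, rfl⟩

theorem Desc.trans {a b c : ℕ} (h₁ : T.Desc a b) (h₂ : T.Desc b c) : T.Desc a c := by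
  obtain ⟨n, rfl⟩ := h₁
  obtain ⟨m, rfl⟩ := h₂
  exact ⟨m + n, Function.iterate_add_apply _ _ _ _⟩

theorem desc_parent (T : WTree) (v : ℕ) : T.Desc v (T.parent v) := ⟨1, rfl⟩

theorem desc_of_mem_children {u c : ℕ} (h : c ∈ T.children u) : T.Desc c u :=
  (mem_children.1 h).2.2 ▸ T.desc_parent c

theorem Desc.total {v a b : ℕ} (ha : T.Desc v a) (hb : T.Desc v b) : T.Desc a b ∨ T.Desc b a := by
  obtain ⟨n, rfl⟩ := ha
  obtain ⟨m, rfl⟩ := hb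
  rcases le_total n m with h | h
  · left
    exact ⟨m - n, by rw [← Function.iterate_add_apply, Nat.sub_add_cancel h]⟩
  · right
    exact ⟨n - m, by rw [← Function.iterate_add_apply, Nat.sub_add_cancel h]⟩

theorem desc_iff {v u : ℕ} : T.Desc v u ↔ v = u ∨ T.Desc (T.parent v) u := by
  constructor
  · rintro ⟨n, rfl⟩
    cases n with
    | zero => left; rfl
    | succ n => right; exact ⟨n, rfl⟩
  · rintro (rfl | h)
    · exact Desc.refl T v
    · exact (T.desc_parent v).trans h

namespace IsSimpleTree

theorem desc_mem (hT : T.IsSimpleTree) {v u : ℕ} (hv : v ∈ T.verts) (h : T.Desc v u) :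
    u ∈ T.verts := by
  obtain ⟨n, rfl⟩ := h
  induction n with
  | zero => exact hv
  | succ n ih => rw [Function.iterate_succ_apply']; exact hT.parent_mem _ ih

theorem iterate_root (hT : T.IsSimpleTree) (n : ℕ) : T.parent^[n] 0 = 0 :=
  Function.iterate_fixed hT.parent_root n

/-- A cycle of the parent map through `v` would be a periodic orbit; as the orbit of `v` reaches the
fixed point `0`, it is constant. -/
theorem antisymm (hT : T.IsSimpleTree) {v u : ℕ} (hv : v ∈ T.verts) (h₁ : T.Desc v u)
    (h₂ : T.Desc u v) : v = u := by
  obtain ⟨n, hn⟩ := h₁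
  obtain ⟨m, hm⟩ := h₂
  obtain ⟨N, hN⟩ := hT.desc_root v hv
  rcases Nat.eq_zero_or_pos n with rfl | hpos
  · exact hn
  have hper : T.parent^[m + n] v = v := by rw [Function.iterate_add_apply, hn, hm]
  have hper' : T.parent^[(m + n) * N] v = v := by
    rw [Function.iterate_mul]; exact Function.iterate_fixed hper N
  have hle : N ≤ (m + n) * N := Nat.le_mul_of_pos_left N (by omega)
  have h0 : v = 0 := by
    rw [← hper', ← Nat.sub_add_cancel hle, Function.iterate_add_apply, hN, hT.iterate_root]
  rw [← hn, h0, hT.iterate_root]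

theorem not_desc_child (hT : T.IsSimpleTree) {u c : ℕ} (hc : c ∈ T.children u) :
    ¬ T.Desc u c := by
  intro h
  obtain ⟨h0, hcv, hp⟩ := mem_children.1 hc
  have hcu : c = u := hT.antisymm hcv (desc_of_mem_children hc) h
  subst hcu
  obtain ⟨n, hn⟩ := hT.desc_root c hcv
  exact h0 (by rw [← hn, Function.iterate_fixed hp])

theorem exists_child (hT : T.IsSimpleTree) {v u : ℕ} (hv : v ∈ T.verts) (h : T.Desc v u)
    (hne : v ≠ u) : ∃ c ∈ T.children u, T.Desc v c := by
  classical
  have hfind : ∃ n, T.parent^[n] v = u := h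
  have hspec := Nat.find_spec hfind
  have hmin := fun m => Nat.find_min hfind (m := m)
  generalize Nat.find hfind = n at hspec hmin
  cases n with
  | zero => exact absurd hspec hne
  | succ n =>
    refine ⟨T.parent^[n] v, ?_, n, rfl⟩
    rw [Function.iterate_succ_apply'] at hspec
    refine mem_children.2 ⟨fun h0 => ?_, hT.desc_mem hv ⟨n, rfl⟩, hspec⟩
    apply hmin n (Nat.lt_succ_self n)
    rw [h0] at hspec ⊢
    rw [← hspec, hT.parent_root]

theorem child_unique (hT : T.IsSimpleTree) {v u c c' : ℕ} (hc : c ∈ T.children u)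
    (hc' : c' ∈ T.children u) (h : T.Desc v c) (h' : T.Desc v c') : c = c' := by
  have key : ∀ {a b : ℕ}, a ∈ T.children u → b ∈ T.children u → T.Desc a b → a = b := by
    intro a b ha hb hab
    rcases desc_iff.1 hab with h | h
    · exact h
    · rw [(mem_children.1 ha).2.2] at h
      exact absurd h (hT.not_desc_child hb)
  rcases h.total h' with h | h
  · exact key hc hc' h
  · exact (key hc' hc h).symm

theorem eq_of_desc_leaf (hT : T.IsSimpleTree) {v f : ℕ} (hv : v ∈ T.verts) (hf : f ∈ T.leaves)
    (h : T.Desc v f) : v = f := by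
  by_contra hne
  obtain ⟨c, hc, -⟩ := hT.exists_child hv h hne
  rw [(mem_leaves.1 hf).2] at hc
  simp at hc

open Classical in
theorem mass_eq (hT : T.IsSimpleTree) (y : ℕ → ℕ) {u : ℕ} (hu : u ∈ T.verts) :
    T.mass y u = y u + ∑ c ∈ T.children u, T.mass y c := by
  unfold mass
  rw [← Finset.sum_biUnion, ← Finset.sum_insert]
  · congr 1
    ext v
    simp only [Finset.mem_filter, Finset.mem_insert, Finset.mem_biUnion]
    constructor
    · rintro ⟨hv, h⟩
      by_cases hne : v = u
      · exact Or.inl hne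
      · obtain ⟨c, hc, hd⟩ := hT.exists_child hv h hne
        exact Or.inr ⟨c, hc, hv, hd⟩
    · rintro (rfl | ⟨c, hc, hv, hd⟩)
      · exact ⟨hu, Desc.refl T v⟩
      · exact ⟨hv, hd.trans (desc_of_mem_children hc)⟩
  · simp only [Finset.mem_biUnion, Finset.mem_filter, not_exists, not_and]
    intro c hc _
    exact hT.not_desc_child hc
  · intro c hc c' hc' hne
    simp only [Function.onFun]
    rw [Finset.disjoint_left]
    intro v hv hv'
    simp only [Finset.mem_filter] at hv hv'
    exact hne (hT.child_unique hc hc' hv.2 hv'.2)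

theorem mass_leaf (hT : T.IsSimpleTree) (y : ℕ → ℕ) {u : ℕ} (hu : u ∈ T.leaves) :
    T.mass y u = y u := by
  rw [hT.mass_eq y (mem_leaves.1 hu).1, (mem_leaves.1 hu).2]; simp

theorem mass_node (hT : T.IsSimpleTree) {y : ℕ → ℕ} (hy : y ∈ T.configs k) {u : ℕ}
    (hu : u ∈ T.verts) (hl : u ∉ T.leaves) :
    T.mass y u = ∑ c ∈ T.children u, T.mass y c := by
  rw [hT.mass_eq y hu, hy.1 u hl, zero_add]

theorem sum_verts (_hT : T.IsSimpleTree) {y : ℕ → ℕ} (hy : y ∈ T.configs k) :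
    ∑ v ∈ T.verts, y v = k := by
  rw [← hy.2]
  symm
  apply Finset.sum_subset (Finset.filter_subset _ _)
  intro v _ hv
  exact hy.1 v hv

theorem mass_root (hT : T.IsSimpleTree) {y : ℕ → ℕ} (hy : y ∈ T.configs k) :
    T.mass y 0 = k := by
  classical
  rw [← hT.sum_verts hy]
  unfold mass
  congr 1
  ext v
  simp only [Finset.mem_filter, and_iff_left_iff_imp]
  exact hT.desc_root v

theorem mass_le (hT : T.IsSimpleTree) {y : ℕ → ℕ} (hy : y ∈ T.configs k) (u : ℕ) :
    T.mass y u ≤ k := by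
  classical
  rw [← hT.sum_verts hy]
  exact Finset.sum_le_sum_of_subset (Finset.filter_subset _ _)

theorem apply_le (hT : T.IsSimpleTree) {y : ℕ → ℕ} (hy : y ∈ T.configs k) (u : ℕ) :
    y u ≤ k := by
  by_cases hu : u ∈ T.leaves
  · rw [← hT.mass_leaf y hu]; exact hT.mass_le hy u
  · rw [hy.1 u hu]; exact Nat.zero_le k

open Classical in
/-- A property that passes from every inner vertex to one of its children holds along the path from
the vertex to some leaf below it. -/
theorem exists_leaf_path (hT : T.IsSimpleTree) (R : ℕ → Prop)
    (hR : ∀ u ∈ T.verts, u ∉ T.leaves → R u → ∃ c ∈ T.children u, R c) {u : ℕ}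
    (hu : u ∈ T.verts) (h : R u) :
    ∃ f ∈ T.leaves, T.Desc f u ∧ ∀ v, T.Desc f v → T.Desc v u → R v := by
  -- Induction on the number of descendants, which drops strictly from a vertex to its child.
  have key : ∀ n, ∀ u ∈ T.verts, R u → (T.verts.filter fun v => T.Desc v u).card ≤ n →
      ∃ f ∈ T.leaves, T.Desc f u ∧ ∀ v, T.Desc f v → T.Desc v u → R v := by
    intro n
    induction n with
    | zero =>
      intro u hu _ hcard
      have : u ∈ T.verts.filter fun v => T.Desc v u :=
        Finset.mem_filter.2 ⟨hu, Desc.refl T u⟩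
      rw [Finset.card_eq_zero.1 (Nat.le_zero.1 hcard)] at this
      simp at this
    | succ n ih =>
      intro u hu h hcard
      by_cases hl : u ∈ T.leaves
      · refine ⟨u, hl, Desc.refl T u, fun v h₁ h₂ => ?_⟩
        rwa [← hT.antisymm hu h₁ h₂]
      · obtain ⟨c, hc, hRc⟩ := hR u hu hl h
        have hcv := (mem_children.1 hc).2.1
        have hlt : (T.verts.filter fun v => T.Desc v c).card
            < (T.verts.filter fun v => T.Desc v u).card := by
          apply Finset.card_lt_card
          rw [Finset.ssubset_iff_of_subset]
          · exact ⟨u, Finset.mem_filter.2 ⟨hu, Desc.refl T u⟩, fun hm =>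
              hT.not_desc_child hc (Finset.mem_filter.1 hm).2⟩
          · intro v hv
            obtain ⟨hv, hd⟩ := Finset.mem_filter.1 hv
            exact Finset.mem_filter.2 ⟨hv, hd.trans (desc_of_mem_children hc)⟩
        obtain ⟨f, hf, hfc, hpath⟩ := ih c hcv hRc (by omega)
        refine ⟨f, hf, hfc.trans (desc_of_mem_children hc), fun v h₁ h₂ => ?_⟩
        rcases h₁.total hfc with hvc | hcv'
        · exact hpath v h₁ hvc
        · rcases desc_iff.1 hcv' with rfl | hpv
          · exact hRc
          · rw [(mem_children.1 hc).2.2] at hpv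
            rwa [← hT.antisymm hu hpv h₂]
  exact key _ u hu h le_rfl

theorem leaves_nonempty (hT : T.IsSimpleTree) : T.leaves.Nonempty := by
  obtain ⟨f, hf, -⟩ := hT.exists_leaf_path (fun _ => True)
    (fun u hu hl _ => by
      rw [mem_leaves, not_and] at hl
      obtain ⟨c, hc⟩ := Finset.nonempty_iff_ne_empty.2 (hl hu)
      exact ⟨c, hc, trivial⟩) hT.root_mem trivial
  exact ⟨f, hf⟩

/-- If `w` has at least `y + τ` robots below `v`, then climbing from `v` and descending elsewhere one
finds a leaf `f` such that the surplus stays at least `τ` on the way up and is negative on the way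
down. -/
theorem exists_exchange (hT : T.IsSimpleTree) {w y : ℕ → ℕ} (hw : w ∈ T.configs k)
    (hy : y ∈ T.configs k) {τ : ℕ} (hτ : 1 ≤ τ) {v : ℕ} (hv : v ∈ T.verts)
    (h : T.mass y v + τ ≤ T.mass w v) :
    ∃ f ∈ T.leaves, w f < y f ∧
      (∀ u, T.Desc v u → ¬ T.Desc f u → T.mass y u + τ ≤ T.mass w u) ∧
      (∀ u, T.Desc f u → ¬ T.Desc v u → T.mass w u < T.mass y u) := by
  classical
  -- At the root both masses equal `k`, so the surplus falls below `τ` somewhere on the way up; `a`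
  -- below is the first such ancestor.
  have hex : ∃ n, ¬ (T.mass y (T.parent^[n] v) + τ ≤ T.mass w (T.parent^[n] v)) := by
    obtain ⟨n, hn⟩ := hT.desc_root v hv
    refine ⟨n, ?_⟩
    rw [hn, hT.mass_root hw, hT.mass_root hy]
    omega
  have hspec := Nat.find_spec hex
  have hmin := fun m => Nat.find_min hex (m := m)
  generalize Nat.find hex = n at hspec hmin
  cases n with
  | zero => exact absurd h hspec
  | succ n =>
    have hc' := not_not.1 (hmin n (Nat.lt_succ_self n))
    set c := T.parent^[n] v with hcdef
    rw [Function.iterate_succ_apply', ← hcdef] at hspec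
    set a := T.parent c with ha
    have hvc : T.Desc v c := ⟨n, rfl⟩
    have hcv : c ∈ T.verts := hT.desc_mem hv hvc
    have hav : a ∈ T.verts := hT.parent_mem c hcv
    have hc0 : c ≠ 0 := by
      intro h0
      rw [ha, h0, hT.parent_root, ← h0] at hspec
      exact hspec hc'
    have hca : c ∈ T.children a := mem_children.2 ⟨hc0, hcv, rfl⟩
    have hal : a ∉ T.leaves := by
      intro hl
      rw [(mem_leaves.1 hl).2] at hca
      simp at hca
    -- The child `c` of `a` still has surplus `τ` while `a` does not, so some other child has a
    -- deficit, which is then followed down to a leaf.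
    have hex' : ∃ b ∈ T.children a, T.mass w b < T.mass y b := by
      by_contra hcon
      push Not at hcon
      apply hspec
      rw [hT.mass_node hw hav hal, hT.mass_node hy hav hal,
        ← Finset.add_sum_erase _ _ hca, ← Finset.add_sum_erase (T.children a) (T.mass w) hca]
      have : ∑ x ∈ (T.children a).erase c, T.mass y x ≤ ∑ x ∈ (T.children a).erase c, T.mass w x :=
        Finset.sum_le_sum fun b hb => hcon b (Finset.mem_of_mem_erase hb)
      omega
    obtain ⟨b, hb, hlt⟩ := hex'
    have hbc : b ≠ c := by rintro rfl; omega
    obtain ⟨f, hf, hfb, hpath⟩ := hT.exists_leaf_path (fun u => T.mass w u < T.mass y u)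
      (fun u hu hl hlt => by
        rw [hT.mass_node hw hu hl, hT.mass_node hy hu hl] at hlt
        exact Finset.exists_lt_of_sum_lt hlt) (mem_children.1 hb).2.1 hlt
    have hfa : T.Desc f a := hfb.trans (desc_of_mem_children hb)
    refine ⟨f, hf, ?_, ?_, ?_⟩
    · have := hpath f (Desc.refl T f) hfb
      rwa [hT.mass_leaf w hf, hT.mass_leaf y hf] at this
    · rintro u ⟨m, rfl⟩ hfu
      rcases Nat.lt_or_ge m (n + 1) with hm | hm
      · exact not_not.1 (hmin m hm)
      · refine absurd (hfa.trans ⟨m - (n + 1), ?_⟩) hfu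
        rw [ha, hcdef, ← Function.iterate_succ_apply' T.parent n v, ← Function.iterate_add_apply,
          Nat.sub_add_cancel hm]
    · intro u hfu hvu
      rcases hfu.total hfb with hub | hbu
      · exact hpath u hfu hub
      · rcases desc_iff.1 hbu with rfl | hpu
        · exact hlt
        · rw [(mem_children.1 hb).2.2] at hpu
          exact absurd ((hvc.trans (desc_of_mem_children hca)).trans hpu) hvu

end IsSimpleTree

end WTree
-- One-robot moves: change of potential and transport cost
/-- The function `φ(y) = 20 k y + 5 y²`. -/
noncomputable def phi (k : ℕ) : ℝ → ℝ := fun y => 20 * (k : ℝ) * y + 5 * y ^ 2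

/-- The increment `φ(m + 1) - φ(m)`. -/
noncomputable def slope (k m : ℕ) : ℝ := 20 * (k : ℝ) + 10 * m + 5

theorem phi_succ (k m : ℕ) : phi k ((m + 1 : ℕ) : ℝ) = phi k m + slope k m := by
  simp only [phi, slope]; push_cast; ring

theorem phi_nonneg (k m : ℕ) : 0 ≤ phi k m := by
  simp only [phi]; positivity

theorem phi_zero (k : ℕ) : phi k ((0 : ℕ) : ℝ) = 0 := by simp [phi]

/-- One robot moves from `a` to `b`. -/
def swap (y : ℕ → ℕ) (a b : ℕ) : ℕ → ℕ :=
  fun v => y v - (if v = a then 1 else 0) + (if v = b then 1 else 0)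

theorem swap_apply_source {y : ℕ → ℕ} {a b : ℕ} (hab : a ≠ b) : swap y a b a = y a - 1 := by
  simp [swap, hab]

theorem swap_apply_target {y : ℕ → ℕ} {a b : ℕ} (hab : a ≠ b) : swap y a b b = y b + 1 := by
  simp [swap, hab.symm]

theorem swap_apply_of_ne {y : ℕ → ℕ} {a b v : ℕ} (ha : v ≠ a) (hb : v ≠ b) :
    swap y a b v = y v := by
  simp [swap, ha, hb]

theorem swap_add {y : ℕ → ℕ} {a b : ℕ} (ha : 1 ≤ y a) (v : ℕ) :
    swap y a b v + (if v = a then 1 else 0) = y v + (if v = b then 1 else 0) := by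
  unfold swap
  by_cases h : v = a
  · subst h; simp only [if_true]; omega
  · simp [h]

theorem sum_swap_add {y : ℕ → ℕ} {a b : ℕ} (ha : 1 ≤ y a) (s : Finset ℕ) :
    ∑ v ∈ s, swap y a b v + (if a ∈ s then 1 else 0)
      = ∑ v ∈ s, y v + (if b ∈ s then 1 else 0) := by
  have := Finset.sum_congr (rfl : s = s) fun v _ => swap_add (b := b) ha v
  rw [Finset.sum_add_distrib, Finset.sum_add_distrib, Finset.sum_ite_eq', Finset.sum_ite_eq'] at this
  exact this

namespace WTree

variable {T : WTree} {k : ℕ}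

theorem swap_mem {y : ℕ → ℕ} {a b : ℕ} (ha : a ∈ T.leaves) (hb : b ∈ T.leaves) (hya : 1 ≤ y a)
    (hy : y ∈ T.configs k) : swap y a b ∈ T.configs k := by
  refine ⟨fun u hu => ?_, ?_⟩
  · have hua : u ≠ a := by rintro rfl; exact hu ha
    have hub : u ≠ b := by rintro rfl; exact hu hb
    rw [swap_apply_of_ne hua hub, hy.1 u hu]
  · have := sum_swap_add (b := b) hya T.leaves
    rw [if_pos ha, if_pos hb, hy.2] at this
    omega

open Classical in
theorem mass_swap_add {y : ℕ → ℕ} {a b : ℕ} (ha : a ∈ T.verts) (hb : b ∈ T.verts)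
    (hya : 1 ≤ y a) (u : ℕ) :
    T.mass (swap y a b) u + (if T.Desc a u then 1 else 0)
      = T.mass y u + (if T.Desc b u then 1 else 0) := by
  have := sum_swap_add (b := b) hya (T.verts.filter fun v => T.Desc v u)
  simpa [mass, ha, hb] using this

open Classical in
theorem one_le_mass {y : ℕ → ℕ} {a u : ℕ} (ha : a ∈ T.verts) (hya : 1 ≤ y a) (h : T.Desc a u) :
    1 ≤ T.mass y u :=
  hya.trans (Finset.single_le_sum (f := y) (fun _ _ => Nat.zero_le _)
    (Finset.mem_filter.2 ⟨ha, h⟩))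

open Classical in
/-- The edges between `a` and the path from `b` to the root. -/
noncomputable def up (T : WTree) (a b : ℕ) : Finset ℕ :=
  (T.verts.erase 0).filter fun u => T.Desc a u ∧ ¬ T.Desc b u

theorem mem_up {a b u : ℕ} :
    u ∈ T.up a b ↔ (u ≠ 0 ∧ u ∈ T.verts) ∧ T.Desc a u ∧ ¬ T.Desc b u := by
  simp [up]

/-- The length of the edges between `a` and the path from `b` to the root. -/
noncomputable def upLen (T : WTree) (a b : ℕ) : ℝ := ∑ u ∈ T.up a b, T.len u

theorem IsSimpleTree.len_nonneg (hT : T.IsSimpleTree) {u : ℕ} (hu : u ∈ T.verts) :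
    0 ≤ T.len u := by
  by_cases h : u = 0
  · rw [h, hT.len_root]
  · exact (hT.len_pos u hu h).le

theorem IsSimpleTree.len_nonneg_of_mem_up (hT : T.IsSimpleTree) {a b u : ℕ}
    (hu : u ∈ T.up a b) : 0 ≤ T.len u :=
  hT.len_nonneg (mem_up.1 hu).1.2

theorem IsSimpleTree.upLen_nonneg (hT : T.IsSimpleTree) (a b : ℕ) : 0 ≤ T.upLen a b :=
  Finset.sum_nonneg fun _ hu => hT.len_nonneg_of_mem_up hu

theorem IsSimpleTree.upLen_le (hT : T.IsSimpleTree) {a b a' b' : ℕ} (h : T.up a b ⊆ T.up a' b') :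
    T.upLen a b ≤ T.upLen a' b' :=
  Finset.sum_le_sum_of_subset_of_nonneg h fun _ hu _ => hT.len_nonneg_of_mem_up hu

open Classical in
theorem sum_diff_swap (T : WTree) (a b : ℕ) (g h : ℕ → ℝ) :
    ∑ u ∈ T.verts.erase 0, T.len u *
        ((if T.Desc b u ∧ ¬ T.Desc a u then h u else 0) +
          (if T.Desc a u ∧ ¬ T.Desc b u then g u else 0))
      = ∑ u ∈ T.up b a, T.len u * h u + ∑ u ∈ T.up a b, T.len u * g u := by
  simp only [mul_add, Finset.sum_add_distrib, mul_ite, mul_zero, up, Finset.sum_filter]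

/-- Only edges on the path between `a` and `b` change their load. A robot leaving an edge with `m`
robots saves `φ(m) - φ(m - 1)`, which is `slope k m - 10`. -/
theorem potential_swap {y : ℕ → ℕ} {a b : ℕ} (ha : a ∈ T.verts) (hb : b ∈ T.verts)
    (hya : 1 ≤ y a) :
    T.potential (phi k) (swap y a b) = T.potential (phi k) y
      + ∑ u ∈ T.up b a, T.len u * slope k (T.mass y u)
      - ∑ u ∈ T.up a b, T.len u * (slope k (T.mass y u) - 10) := by
  classical
  have key := T.sum_diff_swap a b (fun u => -(slope k (T.mass y u) - 10))
    (fun u => slope k (T.mass y u))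
  simp only [mul_neg, Finset.sum_neg_distrib] at key
  rw [add_sub_assoc, sub_eq_add_neg, ← key]
  unfold potential
  rw [← Finset.sum_add_distrib]
  refine Finset.sum_congr rfl fun u _ => ?_
  rw [← mul_add]
  congr 1
  have hm := mass_swap_add ha hb hya u
  by_cases h₁ : T.Desc a u <;> by_cases h₂ : T.Desc b u <;> simp only [h₁, h₂, if_true, if_false,
    not_true, not_false_iff, and_true, and_false, add_zero, zero_add] at hm ⊢
  · rw [Nat.add_right_cancel hm]
  · rw [← hm, phi_succ]; simp only [slope]; push_cast; ring
  · rw [hm, phi_succ]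
  · rw [hm]

theorem OT_swap {y : ℕ → ℕ} {a b : ℕ} (ha : a ∈ T.verts) (hb : b ∈ T.verts) (hya : 1 ≤ y a) :
    T.OT y (swap y a b) = T.upLen b a + T.upLen a b := by
  classical
  have key := T.sum_diff_swap a b (fun _ => 1) (fun _ => 1)
  simp only [mul_one] at key
  unfold upLen
  rw [← key]
  unfold OT
  refine Finset.sum_congr rfl fun u _ => ?_
  congr 1
  have hm := mass_swap_add ha hb hya u
  by_cases h₁ : T.Desc a u <;> by_cases h₂ : T.Desc b u <;> simp only [h₁, h₂, if_true, if_false,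
    not_true, not_false_iff, and_true, and_false, add_zero, zero_add] at hm ⊢
  · rw [Nat.add_right_cancel hm]; simp
  · rw [← hm]; simp
  · rw [hm]; simp
  · rw [hm]; simp

theorem OT_self (T : WTree) (x : ℕ → ℕ) : T.OT x x = 0 := by simp [OT]

theorem IsSimpleTree.OT_nonneg (hT : T.IsSimpleTree) (x y : ℕ → ℕ) : 0 ≤ T.OT x y :=
  Finset.sum_nonneg fun _ hu =>
    mul_nonneg (hT.len_nonneg (Finset.mem_of_mem_erase hu)) (abs_nonneg _)

theorem IsSimpleTree.OT_triangle (hT : T.IsSimpleTree) (x y z : ℕ → ℕ) :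
    T.OT x z ≤ T.OT x y + T.OT y z := by
  unfold OT
  rw [← Finset.sum_add_distrib]
  refine Finset.sum_le_sum fun u hu => ?_
  rw [← mul_add]
  exact mul_le_mul_of_nonneg_left (abs_sub_le _ _ _) (hT.len_nonneg (Finset.mem_of_mem_erase hu))

theorem IsSimpleTree.potential_nonneg (hT : T.IsSimpleTree) (y : ℕ → ℕ) :
    0 ≤ T.potential (phi k) y :=
  Finset.sum_nonneg fun _ hu =>
    mul_nonneg (hT.len_nonneg (Finset.mem_of_mem_erase hu)) (phi_nonneg _ _)

theorem IsSimpleTree.leaf_root (hT : T.IsSimpleTree) (h : 0 ∈ T.leaves) {v : ℕ}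
    (hv : v ∈ T.verts) : v = 0 :=
  hT.eq_of_desc_leaf hv h (hT.desc_root v hv)

theorem IsSimpleTree.eq_of_OT_eq_zero (hT : T.IsSimpleTree) {x y : ℕ → ℕ}
    (hx : x ∈ T.configs k) (hy : y ∈ T.configs k) (h : T.OT x y = 0) : x = y := by
  funext u
  by_cases hu : u ∈ T.leaves
  · have huv := (mem_leaves.1 hu).1
    rw [← hT.mass_leaf x hu, ← hT.mass_leaf y hu]
    by_cases h0 : u = 0
    · rw [h0, hT.mass_root hx, hT.mass_root hy]
    · have := (Finset.sum_eq_zero_iff_of_nonneg fun v hv =>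
        mul_nonneg (hT.len_nonneg (Finset.mem_of_mem_erase hv)) (abs_nonneg _)).1 h u
        (Finset.mem_erase.2 ⟨h0, huv⟩)
      rcases mul_eq_zero.1 this with h' | h'
      · exact absurd h' (hT.len_pos u huv h0).ne'
      · exact_mod_cast sub_eq_zero.1 (abs_eq_zero.1 h')
  · rw [hx.1 u hu, hy.1 u hu]

/-- Finiteness is what provides all minimizers below and, during an elongation, a first instant at
which a move becomes profitable. -/
theorem configs_finite (T : WTree) (k : ℕ) : (T.configs k).Finite := by
  apply Set.Finite.subset (Set.Finite.image (fun g : T.leaves → Fin (k + 1) =>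
    fun u => if h : u ∈ T.leaves then (g ⟨u, h⟩ : ℕ) else 0) Set.finite_univ)
  intro x hx
  refine ⟨fun u => ⟨x u, ?_⟩, trivial, ?_⟩
  · rw [← hx.2]
    exact Nat.lt_succ_of_le (Finset.single_le_sum (f := x) (fun _ _ => Nat.zero_le _) u.2)
  · funext u
    by_cases h : u ∈ T.leaves
    · simp [h]
    · simp [h, hx.1 u h]

theorem single_mem_configs {l : ℕ} (hl : l ∈ T.leaves) (k : ℕ) :
    Pi.single l k ∈ T.configs k := by
  refine ⟨fun u hu => ?_, ?_⟩
  · have : u ≠ l := by rintro rfl; exact hu hl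
    simp [this]
  · rw [Finset.sum_pi_single']; simp [hl]

/-- The increase of potential plus transport when `w` sends a robot from `l` to `f`. -/
noncomputable def moveCost (T : WTree) (k : ℕ) (w : ℕ → ℕ) (l f : ℕ) : ℝ :=
  T.potential (phi k) (swap w l f) + T.OT w (swap w l f) - T.potential (phi k) w

/-- The unit transport cost is added to the increments `slope` and subtracted from the savings
`slope - 10`; this gives `+ 1` and `- 11`. -/
theorem moveCost_eq {w : ℕ → ℕ} {l f : ℕ} (hl : l ∈ T.verts) (hf : f ∈ T.verts)
    (hw : 1 ≤ w l) :
    T.moveCost k w l f = ∑ u ∈ T.up f l, T.len u * (slope k (T.mass w u) + 1)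
      - ∑ u ∈ T.up l f, T.len u * (slope k (T.mass w u) - 11) := by
  rw [moveCost, potential_swap hl hf hw, OT_swap hl hf hw]
  simp only [upLen, mul_add, mul_sub, Finset.sum_add_distrib, Finset.sum_sub_distrib, mul_one,
    ← Finset.sum_mul]
  ring

/-- The cost of sending a robot of `w` from `l` to `f` against the gain that `y` has from the
opposite move. -/
theorem IsSimpleTree.moveCost_le (hT : T.IsSimpleTree) {w y : ℕ → ℕ} {l f : ℕ}
    (hl : l ∈ T.verts) (hf : f ∈ T.verts) (hw : 1 ≤ w l) (hy : 1 ≤ y f) (a : ℕ → ℝ) (b : ℝ)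
    (ha : ∀ u ∈ T.up l f, (T.mass y u : ℝ) + a u ≤ T.mass w u)
    (hb : ∀ u ∈ T.up f l, (T.mass w u : ℝ) ≤ T.mass y u + b) :
    T.moveCost k w l f ≤ T.potential (phi k) y - T.potential (phi k) (swap y f l)
      + (11 + 10 * b) * T.upLen f l + ∑ u ∈ T.up l f, T.len u * (11 - 10 * a u) := by
  rw [moveCost_eq hl hf hw, potential_swap hf hl hy]
  have h₁ : ∑ u ∈ T.up f l, T.len u * (slope k (T.mass w u) + 1)
      ≤ ∑ u ∈ T.up f l, T.len u * (slope k (T.mass y u) - 10) + (11 + 10 * b) * T.upLen f l := by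
    rw [upLen, Finset.mul_sum, ← Finset.sum_add_distrib]
    refine Finset.sum_le_sum fun u hu => ?_
    have := mul_le_mul_of_nonneg_left (hb u hu) (hT.len_nonneg_of_mem_up hu)
    simp only [slope]
    linarith
  have h₂ : ∑ u ∈ T.up l f, T.len u * slope k (T.mass y u)
      ≤ ∑ u ∈ T.up l f, T.len u * (slope k (T.mass w u) - 11)
        + ∑ u ∈ T.up l f, T.len u * (11 - 10 * a u) := by
    rw [← Finset.sum_add_distrib]
    refine Finset.sum_le_sum fun u hu => ?_
    have := mul_le_mul_of_nonneg_left (ha u hu) (hT.len_nonneg_of_mem_up hu)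
    simp only [slope]
    linarith
  linarith

/-- If moving a robot of `y` from `f` to `l` gains at most `E`, then `f` is not much farther than
`l`. -/
theorem IsSimpleTree.upLen_le_of_gain_le (hT : T.IsSimpleTree) (hk : 2 ≤ k) {y : ℕ → ℕ} {l f : ℕ}
    (hl : l ∈ T.verts) (hf : f ∈ T.verts) (hy : 1 ≤ y f)
    (hi : ∀ u ∈ T.up l f, T.mass y u + 1 ≤ k) {E : ℝ} (hE : 0 ≤ E)
    (h : T.potential (phi k) y - T.potential (phi k) (swap y f l) ≤ E) :
    T.upLen f l ≤ 3 / 2 * T.upLen l f + E / 40 := by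
  rw [potential_swap hf hl hy] at h
  -- Removing a robot from an edge with at least one saves at least `20 k`, and adding one to an
  -- edge with at most `k - 1` costs at most `30 k`. The ratio is the 3/2, and `E / (20 k) ≤ E /
  -- 40`.
  have h₁ : 20 * (k : ℝ) * T.upLen f l
      ≤ ∑ u ∈ T.up f l, T.len u * (slope k (T.mass y u) - 10) := by
    rw [upLen, Finset.mul_sum]
    refine Finset.sum_le_sum fun u hu => ?_
    have h1 : (1 : ℝ) ≤ T.mass y u := by exact_mod_cast one_le_mass hf hy (mem_up.1 hu).2.1
    have := hT.len_nonneg_of_mem_up hu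
    simp only [slope]
    nlinarith
  have h₂ : ∑ u ∈ T.up l f, T.len u * slope k (T.mass y u) ≤ 30 * (k : ℝ) * T.upLen l f := by
    rw [upLen, Finset.mul_sum]
    refine Finset.sum_le_sum fun u hu => ?_
    have h1 : (T.mass y u : ℝ) + 1 ≤ k := by exact_mod_cast hi u hu
    have := hT.len_nonneg_of_mem_up hu
    simp only [slope]
    nlinarith
  have hk' : (2 : ℝ) ≤ k := by exact_mod_cast hk
  by_contra hcon
  push Not at hcon
  nlinarith [mul_le_mul_of_nonneg_right hk' hE,
    mul_lt_mul_of_pos_left hcon (show (0 : ℝ) < 20 * k by linarith)]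

/-! ### Stability, and cheap departures from a leaf -/

/-- `x` cannot be improved by a transport. -/
def Stable (T : WTree) (k : ℕ) (x : ℕ → ℕ) : Prop :=
  ∀ z ∈ T.configs k, T.potential (phi k) x ≤ T.potential (phi k) z + T.OT x z

/-- Every transport from `x` to another configuration makes things worse. -/
def StrictlyStable (T : WTree) (k : ℕ) (x : ℕ → ℕ) : Prop :=
  ∀ z ∈ T.configs k, z ≠ x → T.potential (phi k) x < T.potential (phi k) z + T.OT x z

theorem StrictlyStable.stable {x : ℕ → ℕ} (h : T.StrictlyStable k x) : T.Stable k x := by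
  intro z hz
  by_cases hzx : z = x
  · rw [hzx, OT_self, add_zero]
  · exact (h z hz hzx).le

theorem Stable.moveCost_nonneg {x : ℕ → ℕ} (h : T.Stable k x) (hx : x ∈ T.configs k) {l f : ℕ}
    (hl : l ∈ T.leaves) (hf : f ∈ T.leaves) (hxl : 1 ≤ x l) : 0 ≤ T.moveCost k x l f := by
  have := h _ (swap_mem hl hf hxl hx)
  rw [moveCost]; linarith

theorem IsSimpleTree.len_le_upLen (hT : T.IsSimpleTree) {l f : ℕ} (hl : l ∈ T.verts)
    (hf : f ∈ T.leaves) (hlf : l ≠ f) (hl' : l ∈ T.leaves) : T.len l ≤ T.upLen l f := by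
  by_cases h0 : l = 0
  · rw [h0, hT.len_root]; exact hT.upLen_nonneg _ _
  · refine Finset.single_le_sum (f := T.len) (fun u hu => hT.len_nonneg_of_mem_up hu)
      (mem_up.2 ⟨⟨h0, hl⟩, Desc.refl T l, fun h => hlf ?_⟩)
    exact (hT.eq_of_desc_leaf (mem_leaves.1 hf).1 hl' h).symm

/-- If a configuration has on a leaf at least two robots less than a stable one, then it is improved
by sending a robot there. -/
theorem IsSimpleTree.exists_gain (hT : T.IsSimpleTree) (hk : 2 ≤ k) {x y : ℕ → ℕ}
    (hx : x ∈ T.configs k) (hy : y ∈ T.configs k) (hs : T.Stable k x) {l : ℕ} (hl : l ∈ T.leaves)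
    (h : y l + 2 ≤ x l) :
    ∃ j ∈ T.leaves, j ≠ l ∧ 1 ≤ y j ∧ l ≠ 0 ∧
      T.potential (phi k) (swap y j l) + T.OT y (swap y j l) + 4 * T.len l
        ≤ T.potential (phi k) y := by
  have hlv := (mem_leaves.1 hl).1
  obtain ⟨j, hj, hlt, hup, hdown⟩ := hT.exists_exchange hx hy (τ := 2) (by norm_num) hlv
    (by rwa [hT.mass_leaf x hl, hT.mass_leaf y hl])
  have hjv := (mem_leaves.1 hj).1
  have hjl : j ≠ l := by rintro rfl; omega
  have hyj : 1 ≤ y j := by omega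
  have hxl : 1 ≤ x l := by omega
  have hl0 : l ≠ 0 := by
    rintro rfl
    rw [← hT.mass_leaf y hl, ← hT.mass_leaf x hl, hT.mass_root hx, hT.mass_root hy] at h
    omega
  refine ⟨j, hj, hjl, hyj, hl0, ?_⟩
  have hM := hs.moveCost_nonneg hx hl hj hxl
  -- A surplus of 2 going up gives the coefficient `11 - 20 = -9`, a deficit of 1 going down gives
  -- `11 - 10 = 1`. So the gain of `y` is at least `9 I - J`, with `I` the ascent and `J` the
  -- descent.
  have hC := hT.moveCost_le (k := k) hlv hjv hxl hyj (fun _ => 2) (-1)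
    (fun u hu => by exact_mod_cast hup u (mem_up.1 hu).2.1 (mem_up.1 hu).2.2)
    (fun u hu => by
      have : (T.mass x u : ℝ) + 1 ≤ T.mass y u := by
        exact_mod_cast hdown u (mem_up.1 hu).2.1 (mem_up.1 hu).2.2
      linarith)
  rw [← Finset.sum_mul, ← upLen] at hC
  have hI := hT.upLen_nonneg l j
  have hJ := hT.upLen_nonneg j l
  have hlen := hT.len_le_upLen hlv hj hjl.symm hl
  have hA := hT.upLen_le_of_gain_le hk hlv hjv hyj (fun u hu => by
      have := hup u (mem_up.1 hu).2.1 (mem_up.1 hu).2.2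
      have := hT.mass_le hx u
      omega) (le_max_right _ 0) (le_max_left _ _)
  rw [OT_swap hjv hlv hyj]
  -- The bound `J ≤ 3/2 I + E/40` needs `E ≥ 0`, whence the positive part of the gain. In both cases
  -- the gain covers `I + J` and leaves `4 I ≥ 4 d_l`.
  rcases le_total (T.potential (phi k) y - T.potential (phi k) (swap y j l)) 0 with hneg | hpos
  · rw [max_eq_right hneg] at hA
    linarith
  · rw [max_eq_left hpos] at hA
    linarith

/-- If `w` exceeds `y` by two robots below `q` and by one robot on the way from the leaf `l` to `q`,
then a robot of `w` can leave `l` cheaply. -/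
theorem IsSimpleTree.exists_cheap_move_of_gap (hT : T.IsSimpleTree) (hk : 2 ≤ k) {w y : ℕ → ℕ}
    (hw : w ∈ T.configs k) (hy : y ∈ T.configs k) {l q : ℕ} (hl : l ∈ T.leaves) (hlq : T.Desc l q)
    (hq : T.mass y q + 2 ≤ T.mass w q)
    (hlow : ∀ u, T.Desc l u → ¬ T.Desc q u → T.mass y u + 1 ≤ T.mass w u)
    {E : ℝ} (hE : 0 ≤ E)
    (hgain : ∀ f ∈ T.leaves, f ≠ l → 1 ≤ y f →
      T.potential (phi k) y - T.potential (phi k) (swap y f l) ≤ E) :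
    ∃ f ∈ T.leaves, f ≠ l ∧ T.moveCost k w l f ≤ 41 / 40 * E + 5 / 2 * T.upLen l q := by
  classical
  have hlv := (mem_leaves.1 hl).1
  obtain ⟨f, hf, hlt, hup, hdown⟩ := hT.exists_exchange hw hy (τ := 2) (by norm_num)
    (hT.desc_mem hlv hlq) hq
  have hfv := (mem_leaves.1 hf).1
  have hge : ∀ u, T.Desc l u → ¬ T.Desc f u → T.mass y u + 1 ≤ T.mass w u := by
    intro u hu hfu
    by_cases hqu : T.Desc q u
    · have := hup u hqu hfu; omega
    · exact hlow u hu hqu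
  have hwl : y l + 1 ≤ w l := by
    rw [← hT.mass_leaf y hl, ← hT.mass_leaf w hl]
    by_cases hql : T.Desc q l
    · rw [hT.antisymm hlv hlq hql]; omega
    · exact hlow l (Desc.refl T l) hql
  have hfl : f ≠ l := by rintro rfl; omega
  have hyf : 1 ≤ y f := by omega
  refine ⟨f, hf, hfl, ?_⟩
  have hC := hT.moveCost_le (k := k) (w := w) hlv hfv (by omega) hyf
    (fun u => if T.Desc q u then 2 else 1) (-1)
    (fun u hu => by
      obtain ⟨-, h₁, h₂⟩ := mem_up.1 hu
      split_ifs with hqu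
      · exact_mod_cast hup u hqu h₂
      · exact_mod_cast hge u h₁ h₂)
    (fun u hu => by
      obtain ⟨-, h₁, h₂⟩ := mem_up.1 hu
      have : (T.mass w u : ℝ) + 1 ≤ T.mass y u := by
        exact_mod_cast hdown u h₁ fun h => h₂ (hlq.trans h)
      linarith)
  have hA := hT.upLen_le_of_gain_le hk hlv hfv hyf (fun u hu => by
      have := hge u (mem_up.1 hu).2.1 (mem_up.1 hu).2.2
      have := hT.mass_le hw u
      omega) hE (hgain f hf hfl hyf)
  -- The 3/2 accounts for the descent. Above `q` the surplus 2 contributes `-9` and the total is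
  -- negative; below `q` the surplus 1 contributes `+1`, for a total of 5/2.
  have hS : 3 / 2 * T.upLen l f
      + ∑ u ∈ T.up l f, T.len u * (11 - 10 * if T.Desc q u then (2 : ℝ) else 1)
      ≤ 5 / 2 * T.upLen l q := by
    have h₁ : 3 / 2 * T.upLen l f
        + ∑ u ∈ T.up l f, T.len u * (11 - 10 * if T.Desc q u then (2 : ℝ) else 1)
        ≤ ∑ u ∈ T.up l f, if T.Desc q u then 0 else 5 / 2 * T.len u := by
      rw [upLen, Finset.mul_sum, ← Finset.sum_add_distrib]
      refine Finset.sum_le_sum fun u hu => ?_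
      have := hT.len_nonneg_of_mem_up hu
      split_ifs <;> linarith
    refine h₁.trans ?_
    rw [upLen, Finset.mul_sum]
    have hflip : ∀ u, (if T.Desc q u then 0 else 5 / 2 * T.len u)
        = if ¬ T.Desc q u then 5 / 2 * T.len u else 0 := by
      intro u; split_ifs <;> simp_all
    simp only [hflip]
    rw [← Finset.sum_filter]
    apply Finset.sum_le_sum_of_subset_of_nonneg
    · intro u hu
      obtain ⟨hu, hqu⟩ := Finset.mem_filter.1 hu
      obtain ⟨h₀, h₁, -⟩ := mem_up.1 hu
      exact mem_up.2 ⟨h₀, h₁, hqu⟩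
    · intro u hu _
      have := hT.len_nonneg_of_mem_up hu
      linarith
  have hg := hgain f hf hfl hyf
  linarith

/-- The last robot of `w` can leave the leaf `l` cheaply if `y`, which has no robot there, gains by
sending one. -/
theorem IsSimpleTree.exists_cheap_last_move (hT : T.IsSimpleTree) (hk : 2 ≤ k) {w y : ℕ → ℕ}
    (hw : w ∈ T.configs k) (hy : y ∈ T.configs k) {l j : ℕ} (hl : l ∈ T.leaves)
    (hj : j ∈ T.leaves) (hjl : j ≠ l) (hwl : y l + 1 ≤ w l) (hyj : 1 ≤ y j)
    {E : ℝ} (hE : T.upLen l j ≤ E)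
    (hgain : ∀ f ∈ T.leaves, f ≠ l → 1 ≤ y f →
      T.potential (phi k) y - T.potential (phi k) (swap y f l) ≤ E) :
    ∃ f ∈ T.leaves, f ≠ l ∧ T.moveCost k w l f ≤ 19 * E := by
  classical
  have hE0 : 0 ≤ E := (hT.upLen_nonneg l j).trans hE
  have hlv := (mem_leaves.1 hl).1
  have hjv := (mem_leaves.1 hj).1
  have hw1 : 1 ≤ w l := by omega
  obtain ⟨f, hf, hlt, hup, hdown⟩ := hT.exists_exchange hw hy (τ := 1) le_rfl hlv
    (by rwa [hT.mass_leaf w hl, hT.mass_leaf y hl])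
  -- Easy case: the path from `l` to `f` turns down no later than the path from `l` to `j`, so its
  -- ascent is at most `E`.
  by_cases hsub : ∀ u, T.Desc l u → ¬ T.Desc f u → ¬ T.Desc j u
  · have hfv := (mem_leaves.1 hf).1
    have hfl : f ≠ l := by rintro rfl; omega
    have hyf : 1 ≤ y f := by omega
    refine ⟨f, hf, hfl, ?_⟩
    have hC := hT.moveCost_le (k := k) hlv hfv hw1 hyf (fun _ => 1) (-1)
      (fun u hu => by exact_mod_cast hup u (mem_up.1 hu).2.1 (mem_up.1 hu).2.2)
      (fun u hu => by
        have : (T.mass w u : ℝ) + 1 ≤ T.mass y u := by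
          exact_mod_cast hdown u (mem_up.1 hu).2.1 (mem_up.1 hu).2.2
        linarith)
    rw [← Finset.sum_mul, ← upLen] at hC
    have hg := hgain f hf hfl hyf
    have hA := hT.upLen_le_of_gain_le hk hlv hfv hyf (fun u hu => by
        have := hup u (mem_up.1 hu).2.1 (mem_up.1 hu).2.2
        have := hT.mass_le hw u
        omega) hE0 hg
    have hI : T.upLen l f ≤ T.upLen l j := hT.upLen_le fun u hu => by
      obtain ⟨h₀, h₁, h₂⟩ := mem_up.1 hu
      exact mem_up.2 ⟨h₀, h₁, hsub u h₁ h₂⟩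
    linarith
  push Not at hsub
  obtain ⟨u₀, hlu₀, hfu₀, hju₀⟩ := hsub
  -- Otherwise `f` lies too far up. Let `q` be the vertex where the paths of `l` and `j` meet, and
  -- `c` its child towards `l`; the surplus is at least 1 from `l` up to `c`.
  have hex : ∃ n, T.Desc j (T.parent^[n] l) := by
    obtain ⟨n, hn⟩ := hlu₀
    exact ⟨n, hn ▸ hju₀⟩
  have hspec := Nat.find_spec hex
  have hmin := fun m => Nat.find_min hex (m := m)
  generalize Nat.find hex = n at hspec hmin
  cases n with
  | zero => exact absurd (hT.eq_of_desc_leaf hjv hl hspec) hjl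
  | succ n =>
    set c := T.parent^[n] l with hcdef
    rw [Function.iterate_succ_apply', ← hcdef] at hspec
    set q := T.parent c with hqdef
    have hlc : T.Desc l c := ⟨n, rfl⟩
    have hcv : c ∈ T.verts := hT.desc_mem hlv hlc
    have hlq : T.Desc l q := hlc.trans (T.desc_parent c)
    have hqv : q ∈ T.verts := hT.desc_mem hlv hlq
    have hjc : ¬ T.Desc j c := hmin n (Nat.lt_succ_self n)
    have hc0 : c ≠ 0 := fun h0 => hjc (h0 ▸ hT.desc_root j hjv)
    have hcq : c ∈ T.children q := mem_children.2 ⟨hc0, hcv, rfl⟩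
    have hbelow : ∀ u, T.Desc l u → ¬ T.Desc j u → T.mass y u + 1 ≤ T.mass w u := by
      intro u hlu hju
      refine hup u hlu fun hfu => ?_
      rcases hlu.total hlu₀ with h | h
      · exact hfu₀ (hfu.trans h)
      · exact hju (hju₀.trans h)
    have hlow : ∀ u, T.Desc l u → ¬ T.Desc q u → ¬ T.Desc j u := by
      rintro u ⟨m, rfl⟩ hqu
      apply hmin m
      by_contra hm
      push Not at hm
      refine hqu ⟨m - (n + 1), ?_⟩
      rw [hqdef, hcdef, ← Function.iterate_succ_apply' T.parent n l, ← Function.iterate_add_apply,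
        Nat.sub_add_cancel hm]
    have hI : T.upLen l q ≤ T.upLen l j := hT.upLen_le fun u hu => by
      obtain ⟨h₀, h₁, h₂⟩ := mem_up.1 hu
      exact mem_up.2 ⟨h₀, h₁, hlow u h₁ h₂⟩
    by_cases hq2 : T.mass y q + 2 ≤ T.mass w q
    · obtain ⟨g, hg, hgl, hM⟩ := hT.exists_cheap_move_of_gap hk hw hy hl hlq hq2
        (fun u h₁ h₂ => hbelow u h₁ (hlow u h₁ h₂)) hE0 hgain
      exact ⟨g, hg, hgl, by linarith⟩
    have hqnl : q ∉ T.leaves := fun h => by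
      rw [(mem_leaves.1 h).2] at hcq; simp at hcq
    have hjq : j ≠ q := by rintro h; exact hqnl (h ▸ hj)
    obtain ⟨d, hd, hjd⟩ := hT.exists_child hjv hspec hjq
    have hdc : d ≠ c := by rintro h; exact hjc (h ▸ hjd)
    -- If every other child carrying robots of `y` had a surplus, that of the child above `j` would
    -- add to the surplus of `c`, and `q` would have surplus 2.
    have hex' : ∃ b ∈ T.children q, b ≠ c ∧ T.mass w b ≤ T.mass y b ∧ 1 ≤ T.mass y b := by
      by_contra hcon
      push Not at hcon
      have hyd : 1 ≤ T.mass y d := one_le_mass hjv hyj hjd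
      have hsum : ∑ b ∈ (T.children q).erase c, T.mass y b
          < ∑ b ∈ (T.children q).erase c, T.mass w b := by
        apply Finset.sum_lt_sum
        · intro b hb
          by_contra hlt
          push Not at hlt
          have := hcon b (Finset.mem_of_mem_erase hb) (Finset.ne_of_mem_erase hb) hlt.le
          omega
        · refine ⟨d, Finset.mem_erase.2 ⟨hdc, hd⟩, ?_⟩
          by_contra hle
          push Not at hle
          have := hcon d hd hdc hle
          omega
      apply hq2
      have := hbelow c hlc hjc
      rw [hT.mass_node hw hqv hqnl, hT.mass_node hy hqv hqnl,
        ← Finset.add_sum_erase _ _ hcq, ← Finset.add_sum_erase (T.children q) (T.mass w) hcq]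
      omega
    obtain ⟨b, hb, hbc, hwb, hyb⟩ := hex'
    -- Requiring a strict deficit may be impossible here; it suffices to descend with no surplus and
    -- with some robot of `y`, so that `y` can make the opposite move.
    obtain ⟨g, hg, hgb, hpath⟩ := hT.exists_leaf_path
      (fun u => T.mass w u ≤ T.mass y u ∧ 1 ≤ T.mass y u)
      (fun u hu hul h => by
        by_contra hcon
        push Not at hcon
        obtain ⟨h₁, h₂⟩ := h
        rw [hT.mass_node hw hu hul, hT.mass_node hy hu hul] at h₁
        rw [hT.mass_node hy hu hul] at h₂
        have hle : ∀ e ∈ T.children u, T.mass y e ≤ T.mass w e := by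
          intro e he
          by_contra hlt
          push Not at hlt
          have := hcon e he hlt.le
          omega
        have hzero : ∀ e ∈ T.children u, T.mass y e = 0 := by
          intro e he
          have heq := (Finset.sum_eq_sum_iff_of_le hle).1
            (le_antisymm (Finset.sum_le_sum hle) h₁) e he
          have := hcon e he heq.ge
          omega
        rw [Finset.sum_eq_zero hzero] at h₂
        omega) (mem_children.1 hb).2.1 ⟨hwb, hyb⟩
    have hgv := (mem_leaves.1 hg).1
    have hyg : 1 ≤ y g := by
      rw [← hT.mass_leaf y hg]; exact (hpath g (Desc.refl T g) hgb).2
    have hgq : T.Desc g q := hgb.trans (desc_of_mem_children hb)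
    have hgl : g ≠ l := by
      rintro rfl
      exact hbc (hT.child_unique hb hcq hgb hlc)
    refine ⟨g, hg, hgl, ?_⟩
    have hupg : ∀ u, T.Desc l u → ¬ T.Desc g u → ¬ T.Desc j u := fun u h₁ h₂ =>
      hlow u h₁ fun h => h₂ (hgq.trans h)
    -- Without a deficit the descent `J` has coefficient 11. With `J ≤ 3/2 I + E/40` and `I ≤ E` the
    -- cost is at most `E + 11 (3/2 + 1/40) E + E`, which is below `19 E`.
    have hC := hT.moveCost_le (k := k) hlv hgv hw1 hyg (fun _ => 1) 0
      (fun u hu => by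
        obtain ⟨-, h₁, h₂⟩ := mem_up.1 hu
        exact_mod_cast hbelow u h₁ (hupg u h₁ h₂))
      (fun u hu => by
        obtain ⟨-, h₁, h₂⟩ := mem_up.1 hu
        rw [add_zero]
        have : T.Desc u b := by
          rcases h₁.total hgb with h | h
          · exact h
          · rcases desc_iff.1 h with h | h
            · exact h ▸ Desc.refl T b
            · rw [(mem_children.1 hb).2.2] at h
              exact absurd (hlq.trans h) h₂
        exact_mod_cast (hpath u h₁ this).1)
    rw [← Finset.sum_mul, ← upLen] at hC
    have hgn := hgain g hg hgl hyg
    have hA := hT.upLen_le_of_gain_le hk hlv hgv hyg (fun u hu => by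
        obtain ⟨-, h₁, h₂⟩ := mem_up.1 hu
        have := hbelow u h₁ (hupg u h₁ h₂)
        have := hT.mass_le hw u
        omega) hE0 hgn
    have hIg : T.upLen l g ≤ T.upLen l j := hT.upLen_le fun u hu => by
      obtain ⟨h₀, h₁, h₂⟩ := mem_up.1 hu
      exact mem_up.2 ⟨h₀, h₁, hupg u h₁ h₂⟩
    linarith

/-! ### Attractive leaves and their evacuation -/

/-- A configuration without robots on `l` gains, even after paying for the transport, by sending a
robot to `l`. -/
def Attracts (T : WTree) (k l : ℕ) : Prop :=
  ∀ y ∈ T.configs k, y l = 0 → ∃ j ∈ T.leaves, j ≠ l ∧ 1 ≤ y j ∧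
    T.potential (phi k) (swap y j l) + T.OT y (swap y j l) < T.potential (phi k) y

/-- By the triangle inequality, robots can be moved one at a time while the transport is still
measured from the original `x`. -/
theorem IsSimpleTree.add_OT_swap_le (hT : T.IsSimpleTree) (x w : ℕ → ℕ) (l f : ℕ) :
    T.potential (phi k) (swap w l f) + T.OT x (swap w l f)
      ≤ T.potential (phi k) w + T.OT x w + T.moveCost k w l f := by
  have := hT.OT_triangle x w (swap w l f)
  rw [moveCost]; linarith

/-- Emptying an attractive leaf costs at most a constant times the increase of the minimum of the
potential. -/
theorem IsSimpleTree.exists_evacuation (hT : T.IsSimpleTree) (hk : 2 ≤ k) {x y : ℕ → ℕ}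
    (hx : x ∈ T.configs k) (hy : y ∈ T.configs k) {l : ℕ} (hl : l ∈ T.leaves) (hyl : y l = 0)
    (hP : T.Attracts k l) :
    ∃ w ∈ T.configs k, w l = 0 ∧ ∃ z ∈ T.configs k, T.potential (phi k) z ≤ T.potential (phi k) y ∧
      T.potential (phi k) w + T.OT x w
        ≤ T.potential (phi k) x + 21 * (T.potential (phi k) y - T.potential (phi k) z) := by
  have hlv := (mem_leaves.1 hl).1
  -- `Y n` minimizes the potential among the configurations with at most `n` robots on `l`. Sending
  -- a robot of `Y n` to `l` gains at most `Ψ(Y n) - Ψ(Y (n + 1))`.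
  have hmin : ∀ n : ℕ, ∃ z ∈ T.configs k, z l ≤ n ∧
      ∀ z' ∈ T.configs k, z' l ≤ n → T.potential (phi k) z ≤ T.potential (phi k) z' := by
    intro n
    obtain ⟨z, ⟨hz, hzn⟩, h⟩ := Set.exists_min_image {z | z ∈ T.configs k ∧ z l ≤ n}
      (T.potential (phi k)) ((T.configs_finite k).subset fun _ h => h.1) ⟨y, hy, by omega⟩
    exact ⟨z, hz, hzn, fun z' hz' hn => h z' ⟨hz', hn⟩⟩
  choose Y hYmem hYl hYmin using hmin
  have hswap : ∀ n, ∀ f ∈ T.leaves, f ≠ l → 1 ≤ Y n f →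
      T.potential (phi k) (Y (n + 1)) ≤ T.potential (phi k) (swap (Y n) f l) := by
    intro n f hf hfl h1
    refine hYmin _ _ (swap_mem hf hl h1 (hYmem n)) ?_
    rw [swap_apply_target hfl]
    have := hYl n
    omega
  have hmono : ∀ n m, n ≤ m → T.potential (phi k) (Y m) ≤ T.potential (phi k) (Y n) :=
    fun n m h => hYmin m _ (hYmem n) ((hYl n).trans h)
  -- With `n + 2` robots on `l`, `w` has a surplus of two over `Y n`, so the next departure costs at
  -- most 41/40 of one difference, and the differences telescope. The last robot is left out, since
  -- its surplus is only one.
  have hchain : ∀ n, ∀ w ∈ T.configs k, w l = n + 1 → ∃ w' ∈ T.configs k, w' l = 1 ∧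
      T.potential (phi k) w' + T.OT x w' ≤ T.potential (phi k) w + T.OT x w
        + 41 / 40 * (T.potential (phi k) (Y 0) - T.potential (phi k) (Y n)) := by
    intro n
    induction n with
    | zero => intro w hw hwl; exact ⟨w, hw, hwl, by linarith⟩
    | succ n ih =>
      intro w hw hwl
      have hE := hmono n (n + 1) (Nat.le_succ n)
      obtain ⟨f, hf, hfl, hM⟩ := hT.exists_cheap_move_of_gap hk hw (hYmem n) hl (Desc.refl T l)
        (by rw [hT.mass_leaf w hl, hT.mass_leaf (Y n) hl]; have := hYl n; omega)
        (fun u h₁ h₂ => absurd h₁ h₂)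
        (E := T.potential (phi k) (Y n) - T.potential (phi k) (Y (n + 1))) (by linarith)
        (fun f hf hfl h1 => by have := hswap n f hf hfl h1; linarith)
      have h0 : T.upLen l l = 0 := by
        rw [upLen]
        apply Finset.sum_eq_zero
        intro u hu
        exact absurd (mem_up.1 hu).2.1 (mem_up.1 hu).2.2
      rw [h0] at hM
      obtain ⟨w', hw', hw'l, hle⟩ := ih (swap w l f) (swap_mem hl hf (by omega) hw)
        (by rw [swap_apply_source hfl.symm]; omega)
      refine ⟨w', hw', hw'l, ?_⟩
      have := hT.add_OT_swap_le (k := k) x w l f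
      linarith
  have hY0 : T.potential (phi k) (Y 0) ≤ T.potential (phi k) y := hYmin 0 y hy hyl.le
  rcases Nat.eq_zero_or_pos (x l) with h0 | hpos
  · exact ⟨x, hx, h0, y, hy, le_rfl, by rw [OT_self]; linarith⟩
  obtain ⟨n, hn⟩ : ∃ n, x l = n + 1 := ⟨x l - 1, by omega⟩
  obtain ⟨w, hw, hwl, hle⟩ := hchain n x hx hn
  rw [OT_self, add_zero] at hle
  have hY0l : Y 0 l = 0 := Nat.le_zero.1 (hYl 0)
  obtain ⟨j, hj, hjl, hyj, hlt⟩ := hP (Y 0) (hYmem 0) hY0l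
  have hjv := (mem_leaves.1 hj).1
  rw [OT_swap hjv hlv hyj] at hlt
  have hnk : n + 1 ≤ k := by rw [← hn]; exact hT.apply_le hx l
  have hEn := hmono n k (by omega)
  have hE1 := hmono 1 k (by omega)
  -- Attraction applied to `Y 0` bounds the ascent from `l` to `j` by the gain of sending a robot of
  -- `Y 0` from `j` to `l`, hence by `E`.
  obtain ⟨f, hf, hfl, hM⟩ := hT.exists_cheap_last_move hk hw (hYmem 0) hl hj hjl (by omega) hyj
    (E := T.potential (phi k) (Y 0) - T.potential (phi k) (Y k))
    (by have := hswap 0 j hj hjl hyj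
        have := hT.upLen_nonneg j l
        rw [zero_add] at *
        linarith)
    (fun f hf hfl h1 => by
      have := hswap 0 f hf hfl h1
      rw [zero_add] at *
      linarith)
  refine ⟨swap w l f, swap_mem hl hf (by omega) hw, ?_, Y k, hYmem k, ?_, ?_⟩
  · rw [swap_apply_source hfl.symm]; omega
  · exact (hmono 0 k (Nat.zero_le k)).trans hY0
  -- The constant 21 absorbs `41/40` for the chain and `19` for the last robot.
  · have h1 := hT.add_OT_swap_le (k := k) x w l f
    have h2 := hmono 0 k (Nat.zero_le k)
    linarith

end WTree

/-! ### Elongations -/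

theorem phi_pred_add_one_le {k m : ℕ} (hk : 2 ≤ k) (hm : 1 ≤ m) :
    phi k ((m - 1 : ℕ) : ℝ) + 1 ≤ phi k m := by
  obtain ⟨n, rfl⟩ : ∃ n, m = n + 1 := ⟨m - 1, by omega⟩
  rw [Nat.add_sub_cancel, phi_succ]
  have hk' : (2 : ℝ) ≤ k := by exact_mod_cast hk
  have hn : (0 : ℝ) ≤ n := Nat.cast_nonneg n
  simp only [slope]
  linarith

namespace WTree

variable {T : WTree} {k : ℕ}

theorem IsSimpleTree.elongate (hT : T.IsSimpleTree) {l : ℕ} (hl : l ∈ T.verts) (hl0 : l ≠ 0)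
    {s : ℝ} (hs : 0 ≤ s) : (T.elongate l s).IsSimpleTree where
  root_mem := hT.root_mem
  parent_mem := hT.parent_mem
  desc_root := hT.desc_root
  len_pos := by
    intro u hu hu0
    by_cases h : u = l
    · subst h
      have := hT.len_pos u hu hu0
      simp only [WTree.elongate, Function.update_self]
      linarith
    · simp only [WTree.elongate, Function.update_of_ne h]
      exact hT.len_pos u hu hu0
  simple := hT.simple
  parent_root := hT.parent_root
  len_root := by
    simp only [WTree.elongate, Function.update_of_ne hl0.symm]
    exact hT.len_root
  off_verts := by
    intro u hu
    have h : u ≠ l := by rintro rfl; exact hu hl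
    simp only [WTree.elongate, Function.update_of_ne h]
    exact hT.off_verts u hu

theorem sum_elongate {l : ℕ} (hl : l ∈ T.verts) (hl0 : l ≠ 0) (s : ℝ) (g : ℕ → ℝ) :
    ∑ u ∈ T.verts.erase 0, (T.elongate l s).len u * g u
      = ∑ u ∈ T.verts.erase 0, T.len u * g u + s * g l := by
  have hmem : l ∈ T.verts.erase 0 := Finset.mem_erase.2 ⟨hl0, hl⟩
  rw [← Finset.add_sum_erase _ _ hmem, ← Finset.add_sum_erase _ (fun u => T.len u * g u) hmem]
  have : ∑ u ∈ (T.verts.erase 0).erase l, (T.elongate l s).len u * g u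
      = ∑ u ∈ (T.verts.erase 0).erase l, T.len u * g u := by
    refine Finset.sum_congr rfl fun u hu => ?_
    simp only [elongate, Function.update_of_ne (Finset.ne_of_mem_erase hu)]
  rw [this]
  simp only [elongate, Function.update_self]
  ring

theorem IsSimpleTree.potential_elongate (hT : T.IsSimpleTree) {l : ℕ} (hl : l ∈ T.leaves)
    (hl0 : l ≠ 0) (s : ℝ) (φ : ℝ → ℝ) (y : ℕ → ℕ) :
    (T.elongate l s).potential φ y = T.potential φ y + s * φ (y l) := by
  have := sum_elongate (mem_leaves.1 hl).1 hl0 s (fun u => φ (T.mass y u))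
  simp only [hT.mass_leaf y hl] at this
  exact this

theorem IsSimpleTree.OT_elongate (hT : T.IsSimpleTree) {l : ℕ} (hl : l ∈ T.leaves)
    (hl0 : l ≠ 0) (s : ℝ) (x y : ℕ → ℕ) :
    (T.elongate l s).OT x y = T.OT x y + s * |(x l : ℝ) - y l| := by
  have := sum_elongate (mem_leaves.1 hl).1 hl0 s
    (fun u => |(T.mass x u : ℝ) - T.mass y u|)
  simp only [hT.mass_leaf x hl, hT.mass_leaf y hl] at this
  exact this

/-- On `l` itself, `x` exceeds by two any configuration that leaves `l` empty, so stability forces a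
gain. For another leaf, a longer edge of `l` only makes it more profitable to take a robot from `l`.
-/
theorem IsSimpleTree.attracts_elongate (hT : T.IsSimpleTree) (hk : 2 ≤ k) {x : ℕ → ℕ}
    (hx : x ∈ T.configs k) {l : ℕ} (hl : l ∈ T.leaves) (hl0 : l ≠ 0) (hxl : 2 ≤ x l) {s : ℝ}
    (hs : 0 ≤ s) (hst : (T.elongate l s).Stable k x) (hP : ∀ i ∈ T.leaves, T.Attracts k i) :
    ∀ i ∈ T.leaves, (T.elongate l s).Attracts k i := by
  intro i hi y hy hyi
  have hT' := hT.elongate (mem_leaves.1 hl).1 hl0 hs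
  by_cases hil : i = l
  · subst hil
    obtain ⟨j, hj, hji, hyj, -, hgain⟩ := hT'.exists_gain hk (x := x) hx hy hst hi (by omega)
    have hlen := hT'.len_pos i (mem_leaves.1 hi).1 hl0
    exact ⟨j, hj, hji, hyj, by linarith⟩
  · obtain ⟨j, hj, hji, hyj, hlt⟩ := hP i hi y hy hyi
    refine ⟨j, hj, hji, hyj, ?_⟩
    rw [hT.potential_elongate hl hl0, hT.potential_elongate hl hl0, hT.OT_elongate hl hl0]
    have key : phi k (swap y j i l) + |(y l : ℝ) - swap y j i l| ≤ phi k (y l) := by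
      by_cases hjl : j = l
      · subst hjl
        rw [swap_apply_source hji]
        have h1 := phi_pred_add_one_le hk hyj
        have h2 : |(y j : ℝ) - ((y j - 1 : ℕ) : ℝ)| = 1 := by
          rw [Nat.cast_sub hyj]; simp
        rw [h2]
        exact h1
      · rw [swap_apply_of_ne (Ne.symm hjl) (Ne.symm hil)]; simp
    have := mul_le_mul_of_nonneg_left key hs
    linarith

/-! ### Forks -/

/-- The configuration before a fork of `f`, in which the robots of the new leaves `S` are at `f`. -/
def proj (f : ℕ) (S : Finset ℕ) (y : ℕ → ℕ) : ℕ → ℕ :=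
  fun v => if v = f then y f + ∑ s ∈ S, y s else if v ∈ S then 0 else y v

/-- All robots of `f` move to the new leaf `s`. -/
def lift (f s : ℕ) (y : ℕ → ℕ) : ℕ → ℕ :=
  fun v => if v = f then 0 else if v = s then y f else y v

section Fork

variable {f : ℕ} {S : Finset ℕ} {δ : ℝ}

theorem fork_parent_old (hS : Disjoint S T.verts) {v : ℕ} (hv : v ∈ T.verts) :
    (T.fork f S δ).parent v = T.parent v := by
  simp [fork, Finset.disjoint_right.1 hS hv]

theorem fork_parent_new {s : ℕ} (hs : s ∈ S) : (T.fork f S δ).parent s = f := by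
  simp [fork, hs]

theorem IsSimpleTree.fork_desc_old (hT : T.IsSimpleTree) (hS : Disjoint S T.verts) {v u : ℕ}
    (hv : v ∈ T.verts) : (T.fork f S δ).Desc v u ↔ T.Desc v u := by
  have key : ∀ n, (T.fork f S δ).parent^[n] v = T.parent^[n] v := by
    intro n
    induction n with
    | zero => rfl
    | succ n ih =>
      rw [Function.iterate_succ_apply', Function.iterate_succ_apply', ih,
        fork_parent_old hS (hT.desc_mem hv ⟨n, rfl⟩)]
  simp only [Desc, key]

theorem IsSimpleTree.fork_desc_new (hT : T.IsSimpleTree) (hS : Disjoint S T.verts)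
    (hf : f ∈ T.verts) {s u : ℕ} (hs : s ∈ S) :
    (T.fork f S δ).Desc s u ↔ s = u ∨ T.Desc f u := by
  rw [desc_iff, fork_parent_new hs, hT.fork_desc_old hS hf]

theorem mem_fork_verts {v : ℕ} : v ∈ (T.fork f S δ).verts ↔ v ∈ T.verts ∨ v ∈ S := by
  simp [fork]

theorem fork_children_old (hS : Disjoint S T.verts) {u : ℕ} (huf : u ≠ f) :
    (T.fork f S δ).children u = T.children u := by
  ext c
  rw [mem_children, mem_children, mem_fork_verts]
  constructor
  · rintro ⟨h0, hc | hc, hp⟩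
    · exact ⟨h0, hc, by rwa [fork_parent_old hS hc] at hp⟩
    · rw [fork_parent_new hc] at hp
      exact absurd hp.symm huf
  · rintro ⟨h0, hc, hp⟩
    exact ⟨h0, Or.inl hc, by rwa [fork_parent_old hS hc]⟩

theorem IsSimpleTree.fork_children_self (hT : T.IsSimpleTree) (hS : Disjoint S T.verts)
    (hf : f ∈ T.leaves) : (T.fork f S δ).children f = S := by
  ext c
  rw [mem_children, mem_fork_verts]
  constructor
  · rintro ⟨h0, hc | hc, hp⟩
    · rw [fork_parent_old hS hc] at hp
      have : c ∈ T.children f := mem_children.2 ⟨h0, hc, hp⟩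
      rw [(mem_leaves.1 hf).2] at this
      simp at this
    · exact hc
  · intro hc
    refine ⟨?_, Or.inr hc, fork_parent_new hc⟩
    rintro rfl
    exact Finset.disjoint_left.1 hS hc hT.root_mem

theorem IsSimpleTree.fork_children_new (hT : T.IsSimpleTree) (hS : Disjoint S T.verts)
    (hf : f ∈ T.verts) {s : ℕ} (hs : s ∈ S) : (T.fork f S δ).children s = ∅ := by
  have hsv := Finset.disjoint_left.1 hS hs
  rw [Finset.eq_empty_iff_forall_notMem]
  intro c hc
  obtain ⟨-, hcv, hp⟩ := mem_children.1 hc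
  rcases mem_fork_verts.1 hcv with hcv | hcv
  · rw [fork_parent_old hS hcv] at hp
    exact hsv (hp ▸ hT.parent_mem c hcv)
  · rw [fork_parent_new hcv] at hp
    exact hsv (hp ▸ hf)

theorem IsSimpleTree.fork_leaves (hT : T.IsSimpleTree) (hS : Disjoint S T.verts)
    (hf : f ∈ T.leaves) (hne : S.Nonempty) :
    (T.fork f S δ).leaves = T.leaves.erase f ∪ S := by
  have hfv := (mem_leaves.1 hf).1
  ext u
  rw [mem_leaves, mem_fork_verts, Finset.mem_union, Finset.mem_erase, mem_leaves]
  constructor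
  · rintro ⟨hu | hu, hc⟩
    · have huf : u ≠ f := by
        rintro rfl
        rw [hT.fork_children_self hS hf] at hc
        exact hne.ne_empty hc
      exact Or.inl ⟨huf, hu, by rwa [fork_children_old hS huf] at hc⟩
    · exact Or.inr hu
  · rintro (⟨huf, hu, hc⟩ | hu)
    · exact ⟨Or.inl hu, by rwa [fork_children_old hS huf]⟩
    · exact ⟨Or.inr hu, hT.fork_children_new hS hfv hu⟩

theorem IsSimpleTree.fork (hT : T.IsSimpleTree) (hS : Disjoint S T.verts)
    (hf : f ∈ T.leaves) (hcard : 2 ≤ S.card) (hδ : 0 < δ) : (T.fork f S δ).IsSimpleTree := by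
  have hfv := (mem_leaves.1 hf).1
  have h0S : (0 : ℕ) ∉ S := fun h => Finset.disjoint_left.1 hS h hT.root_mem
  refine ⟨mem_fork_verts.2 (Or.inl hT.root_mem), ?_, ?_, ?_, ?_, ?_, ?_, ?_⟩
  · intro u hu
    rw [mem_fork_verts]
    rcases mem_fork_verts.1 hu with hu | hu
    · rw [fork_parent_old hS hu]; exact Or.inl (hT.parent_mem u hu)
    · rw [fork_parent_new hu]; exact Or.inl hfv
  · intro u hu
    rcases mem_fork_verts.1 hu with hu | hu
    · exact (hT.fork_desc_old hS hu).2 (hT.desc_root u hu)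
    · exact (hT.fork_desc_new hS hfv hu).2 (Or.inr (hT.desc_root f hfv))
  · intro u hu hu0
    rcases mem_fork_verts.1 hu with hu | hu
    · simpa [WTree.fork, Finset.disjoint_right.1 hS hu] using hT.len_pos u hu hu0
    · simpa [WTree.fork, hu] using hδ
  · intro u hu hu0
    rcases mem_fork_verts.1 hu with hu | hu
    · by_cases huf : u = f
      · rw [huf, hT.fork_children_self hS hf]; omega
      · rw [fork_children_old hS huf]; exact hT.simple u hu hu0
    · rw [hT.fork_children_new hS hfv hu]; simp
  · rw [fork_parent_old hS hT.root_mem, hT.parent_root]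
  · simpa [WTree.fork, h0S] using hT.len_root
  · intro u hu
    rw [mem_fork_verts, not_or] at hu
    simpa [WTree.fork, hu.2] using hT.off_verts u hu.1

theorem IsSimpleTree.fork_mass_old (hT : T.IsSimpleTree) (hS : Disjoint S T.verts)
    (hf : f ∈ T.verts) (y : ℕ → ℕ) {u : ℕ} (hu : u ∈ T.verts) :
    (T.fork f S δ).mass y u = T.mass (proj f S y) u := by
  classical
  have h1 : (T.fork f S δ).mass y u
      = ∑ v ∈ T.verts, (if T.Desc v u then y v else 0) + ∑ s ∈ S, (if T.Desc f u then y s else 0) := by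
    unfold mass
    rw [Finset.sum_filter]
    change ∑ v ∈ T.verts ∪ S, _ = _
    rw [Finset.sum_union hS.symm]
    congr 1
    · refine Finset.sum_congr rfl fun v hv => ?_
      simp only [hT.fork_desc_old hS hv]
    · refine Finset.sum_congr rfl fun s hs => ?_
      have hsu : s ≠ u := by rintro rfl; exact Finset.disjoint_left.1 hS hs hu
      simp only [hT.fork_desc_new hS hf hs, hsu, false_or]
  have h2 : T.mass (proj f S y) u
      = ∑ v ∈ T.verts, ((if T.Desc v u then y v else 0)
        + if v = f then (if T.Desc f u then ∑ s ∈ S, y s else 0) else 0) := by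
    unfold mass
    rw [Finset.sum_filter]
    refine Finset.sum_congr rfl fun v hv => ?_
    have hvS := Finset.disjoint_right.1 hS hv
    by_cases hvf : v = f
    · subst hvf
      simp only [proj, if_true]
      split_ifs <;> simp
    · simp [proj, hvf, hvS]
  rw [h1, h2, Finset.sum_add_distrib, Finset.sum_ite_eq', if_pos hf]
  congr 1
  split_ifs <;> simp

theorem IsSimpleTree.fork_mass_new (hT : T.IsSimpleTree) (hS : Disjoint S T.verts)
    (hf : f ∈ T.leaves) (hcard : 2 ≤ S.card) (hδ : 0 < δ) (y : ℕ → ℕ) {s : ℕ} (hs : s ∈ S) :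
    (T.fork f S δ).mass y s = y s := by
  apply (hT.fork hS hf hcard hδ).mass_leaf
  rw [hT.fork_leaves hS hf (Finset.card_pos.1 (by omega))]
  exact Finset.mem_union_right _ hs

theorem IsSimpleTree.sum_fork (hT : T.IsSimpleTree) (hS : Disjoint S T.verts) (g : ℕ → ℝ) :
    ∑ u ∈ (T.fork f S δ).verts.erase 0, (T.fork f S δ).len u * g u
      = ∑ u ∈ T.verts.erase 0, T.len u * g u + δ * ∑ s ∈ S, g s := by
  have h0S : (0 : ℕ) ∉ S := fun h => Finset.disjoint_left.1 hS h hT.root_mem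
  change ∑ u ∈ (T.verts ∪ S).erase 0, _ = _
  rw [Finset.erase_union_distrib, Finset.erase_eq_of_notMem h0S, Finset.sum_union, Finset.mul_sum]
  · congr 1
    · refine Finset.sum_congr rfl fun u hu => ?_
      simp [WTree.fork, Finset.disjoint_right.1 hS (Finset.mem_of_mem_erase hu)]
    · refine Finset.sum_congr rfl fun u hu => ?_
      simp [WTree.fork, hu]
  · exact hS.symm.mono_left (Finset.erase_subset _ _)

theorem IsSimpleTree.fork_potential (hT : T.IsSimpleTree) (hS : Disjoint S T.verts)
    (hf : f ∈ T.leaves) (hcard : 2 ≤ S.card) (hδ : 0 < δ) (φ : ℝ → ℝ) (y : ℕ → ℕ) :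
    (T.fork f S δ).potential φ y = T.potential φ (proj f S y) + δ * ∑ s ∈ S, φ (y s) := by
  unfold potential
  rw [hT.sum_fork hS]
  congr 1
  · refine Finset.sum_congr rfl fun u hu => ?_
    rw [hT.fork_mass_old hS (mem_leaves.1 hf).1 y (Finset.mem_of_mem_erase hu)]
  · congr 1
    refine Finset.sum_congr rfl fun s hs => ?_
    rw [hT.fork_mass_new hS hf hcard hδ y hs]

theorem IsSimpleTree.fork_OT (hT : T.IsSimpleTree) (hS : Disjoint S T.verts)
    (hf : f ∈ T.leaves) (hcard : 2 ≤ S.card) (hδ : 0 < δ) (x y : ℕ → ℕ) :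
    (T.fork f S δ).OT x y
      = T.OT (proj f S x) (proj f S y) + δ * ∑ s ∈ S, |(x s : ℝ) - y s| := by
  unfold OT
  rw [hT.sum_fork hS]
  congr 1
  · refine Finset.sum_congr rfl fun u hu => ?_
    rw [hT.fork_mass_old hS (mem_leaves.1 hf).1 x (Finset.mem_of_mem_erase hu),
      hT.fork_mass_old hS (mem_leaves.1 hf).1 y (Finset.mem_of_mem_erase hu)]
  · congr 1
    refine Finset.sum_congr rfl fun s hs => ?_
    rw [hT.fork_mass_new hS hf hcard hδ x hs, hT.fork_mass_new hS hf hcard hδ y hs]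

theorem notMem_of_mem_leaves (hS : Disjoint S T.verts) {v : ℕ} (hv : v ∈ T.leaves) : v ∉ S :=
  Finset.disjoint_right.1 hS (mem_leaves.1 hv).1

theorem proj_of_config (hS : Disjoint S T.verts) {y : ℕ → ℕ} (hy : y ∈ T.configs k) :
    proj f S y = y := by
  have h0 : ∀ s ∈ S, y s = 0 := fun s hs => hy.1 s fun h => notMem_of_mem_leaves hS h hs
  funext v
  unfold proj
  split_ifs with h1 h2
  · rw [h1, Finset.sum_eq_zero h0, add_zero]
  · exact (h0 v h2).symm
  · rfl

theorem IsSimpleTree.proj_mem (hT : T.IsSimpleTree) (hS : Disjoint S T.verts) (hf : f ∈ T.leaves)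
    (hne : S.Nonempty) {y : ℕ → ℕ} (hy : y ∈ (T.fork f S δ).configs k) :
    proj f S y ∈ T.configs k := by
  have hfS := notMem_of_mem_leaves hS hf
  have hL := hT.fork_leaves (δ := δ) hS hf hne
  have hyf : y f = 0 := hy.1 f (by rw [hL]; simp [hfS])
  refine ⟨fun u hu => ?_, ?_⟩
  · have huf : u ≠ f := by rintro rfl; exact hu hf
    by_cases huS : u ∈ S
    · simp [proj, huf, huS]
    · simp only [proj, huf, huS, if_false]
      exact hy.1 u (by rw [hL]; simp [hu, huS])
  · rw [← hy.2, hL, Finset.sum_union, ← Finset.add_sum_erase _ _ hf, add_comm]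
    · congr 1
      · refine Finset.sum_congr rfl fun u hu => ?_
        simp [proj, Finset.ne_of_mem_erase hu,
          notMem_of_mem_leaves hS (Finset.mem_of_mem_erase hu)]
      · simp [proj, hyf]
    · rw [Finset.disjoint_left]
      intro u hu
      exact notMem_of_mem_leaves hS (Finset.mem_of_mem_erase hu)

theorem IsSimpleTree.lift_mem (hT : T.IsSimpleTree) (hS : Disjoint S T.verts) (hf : f ∈ T.leaves)
    {s : ℕ} (hs : s ∈ S) {y : ℕ → ℕ} (hy : y ∈ T.configs k) :
    lift f s y ∈ (T.fork f S δ).configs k ∧ proj f S (lift f s y) = y ∧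
      lift f s y s = y f ∧ ∀ s' ∈ S, s' ≠ s → lift f s y s' = 0 := by
  have hfS := notMem_of_mem_leaves hS hf
  have hsf : s ≠ f := by rintro rfl; exact hfS hs
  have h0 : ∀ s ∈ S, y s = 0 := fun s hs => hy.1 s fun h => notMem_of_mem_leaves hS h hs
  have hL := hT.fork_leaves (δ := δ) hS hf ⟨s, hs⟩
  have hnew : ∀ s' ∈ S, s' ≠ s → lift f s y s' = 0 := by
    intro s' hs' hne
    have : s' ≠ f := by rintro rfl; exact hfS hs'
    simp [lift, this, hne, h0 s' hs']
  have hself : lift f s y s = y f := by simp [lift, hsf]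
  have hsum : ∑ s' ∈ S, lift f s y s' = y f := by
    rw [Finset.sum_eq_single s (fun b hb hne => hnew b hb hne) (fun h => absurd hs h), hself]
  refine ⟨⟨fun u hu => ?_, ?_⟩, ?_, hself, hnew⟩
  · rw [hL, Finset.mem_union, not_or, Finset.mem_erase, not_and] at hu
    by_cases huf : u = f
    · simp [lift, huf]
    · have hus : u ≠ s := by rintro rfl; exact hu.2 hs
      simp only [lift, huf, hus, if_false]
      exact hy.1 u (hu.1 huf)
  · rw [hL, Finset.sum_union, hsum, ← hy.2, ← Finset.add_sum_erase _ _ hf, add_comm]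
    · congr 1
      refine Finset.sum_congr rfl fun u hu => ?_
      have hus : u ≠ s := by
        rintro rfl; exact notMem_of_mem_leaves hS (Finset.mem_of_mem_erase hu) hs
      simp [lift, Finset.ne_of_mem_erase hu, hus]
    · rw [Finset.disjoint_left]
      intro u hu
      exact notMem_of_mem_leaves hS (Finset.mem_of_mem_erase hu)
  · funext v
    unfold proj
    split_ifs with h1 h2
    · rw [h1, hsum]; simp [lift]
    · exact (h0 v h2).symm
    · have hvs : v ≠ s := by rintro rfl; exact h2 hs
      simp [lift, h1, hvs]

/-- A move of one robot seen before the fork. -/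
theorem proj_swap {y : ℕ → ℕ} {a b : ℕ} (hfS : f ∉ S) (ha : 1 ≤ y a) :
    proj f S (swap y a b)
      = swap (proj f S y) (if a ∈ S then f else a) (if b ∈ S then f else b) := by
  -- Projecting the indicator of `c` gives the indicator of the image of `c`. The comparison below
  -- adds indicators on both sides to avoid the truncated subtraction in `swap`.
  have key : ∀ (c v : ℕ), (if v = f then (if f = c then 1 else 0) + (if c ∈ S then 1 else 0)
      else if v ∈ S then 0 else if v = c then 1 else 0)
      = if v = (if c ∈ S then f else c) then 1 else 0 := by
    intro c v
    by_cases hvf : v = f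
    · subst hvf
      by_cases hc : c ∈ S
      · have : v ≠ c := by rintro rfl; exact hfS hc
        simp [hc, this]
      · simp [hc]
    · by_cases hc : c ∈ S
      · simp only [hvf, hc, if_true, if_false]
        split_ifs with h1 h2
        · rfl
        · exact absurd (h2 ▸ hc) h1
        · rfl
      · simp only [hvf, hc, if_false]
        split_ifs with h1 h2 h2
        · exact absurd (h2 ▸ h1) hc
        all_goals rfl
  have hpa : 1 ≤ proj f S y (if a ∈ S then f else a) := by
    by_cases h : a ∈ S
    · have := Finset.single_le_sum (f := y) (fun _ _ => Nat.zero_le _) h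
      simp only [h, if_true, proj]; omega
    · by_cases haf : a = f
      · subst haf; simp only [h, if_false, proj, if_true]; omega
      · simpa [h, haf, proj] using ha
  funext v
  have h1 := swap_add (b := if b ∈ S then f else b) hpa v
  have h2 : proj f S (swap y a b) v + (if v = (if a ∈ S then f else a) then 1 else 0)
      = proj f S y v + (if v = (if b ∈ S then f else b) then 1 else 0) := by
    rw [← key a v, ← key b v]
    by_cases hvf : v = f
    · subst hvf
      have hv := swap_add (b := b) ha v
      have hs := sum_swap_add (b := b) ha S
      simp only [proj, if_true]
      linarith
    · by_cases hvS : v ∈ S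
      · simp only [proj, hvf, hvS, if_true, if_false]
      · simp only [proj, hvf, hvS, if_false]
        exact swap_add ha v
  exact Nat.add_right_cancel (h2.trans h1.symm)

end Fork

/-! ### Kills -/

/-- The leaf `l` and its edge are removed. -/
def prune (T : WTree) (l : ℕ) : WTree where
  verts := T.verts.erase l
  parent := fun v => if v = l then v else T.parent v
  len := fun v => if v = l then 0 else T.len v

/-- The leaf `l` and its parent are removed, and the siblings of `l` are attached to its
grandparent. -/
noncomputable def splice (T : WTree) (l : ℕ) : WTree where
  verts := (T.verts.erase l).erase (T.parent l)
  parent := fun v => if v = l ∨ v = T.parent l then v else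
    if v ∈ T.siblings l then T.parent (T.parent l) else T.parent v
  len := fun v => if v = l ∨ v = T.parent l then 0 else
    if v ∈ T.siblings l then T.len (T.parent l) + T.len v else T.len v

theorem kill_eq_splice {l : ℕ} (h : T.parent l ≠ 0 ∧ (T.siblings l).card = 1) :
    T.kill l = T.splice l := if_pos h

theorem kill_eq_prune {l : ℕ} (h : ¬ (T.parent l ≠ 0 ∧ (T.siblings l).card = 1)) :
    T.kill l = T.prune l := if_neg h

/-- `T'` is a simple tree that arises from `T` by the removal of the leaf `l`, and the
configurations without robots on `l` have the same potential and transport costs in both trees. -/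
structure Removes (T T' : WTree) (l : ℕ) : Prop where
  isSimple : T'.IsSimpleTree
  verts_subset : T'.verts ⊆ T.verts
  notMem : l ∉ T'.verts
  leaves_eq : T'.leaves = T.leaves.erase l
  potential_eq : ∀ (k : ℕ) (φ : ℝ → ℝ) (y : ℕ → ℕ), φ ((0 : ℕ) : ℝ) = 0 → y ∈ T.configs k →
    y l = 0 → T'.potential φ y = T.potential φ y
  OT_eq : ∀ (k : ℕ) (x y : ℕ → ℕ), x ∈ T.configs k → x l = 0 → y ∈ T.configs k → y l = 0 →
    T'.OT x y = T.OT x y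

theorem CanKill.ne_root (hT : T.IsSimpleTree) {l : ℕ} (h : T.CanKill l) : l ≠ 0 := by
  obtain ⟨hl, l', hl', hne⟩ := h
  rintro rfl
  exact hne (hT.leaf_root hl (mem_leaves.1 hl').1)

theorem parent_ne_leaf (hT : T.IsSimpleTree) {l v : ℕ} (hl : l ∈ T.leaves) (hl0 : l ≠ 0)
    (hv : v ∈ T.verts) : T.parent v ≠ l := by
  intro h
  by_cases hv0 : v = 0
  · rw [hv0, hT.parent_root] at h
    exact hl0 h.symm
  · have : v ∈ T.children l := mem_children.2 ⟨hv0, hv, h⟩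
    rw [(mem_leaves.1 hl).2] at this
    simp at this

/-- The parent of a killed leaf does not become a leaf: if it is the root, the path from the other
leaf enters through another child; if not, simplicity excludes an only child. -/
theorem CanKill.children_parent_ne (hT : T.IsSimpleTree) {l : ℕ} (h : T.CanKill l) :
    T.children (T.parent l) ≠ {l} := by
  intro hch
  have hlv := (mem_leaves.1 h.1).1
  by_cases hp : T.parent l = 0
  · obtain ⟨hl, l', hl', hne⟩ := id h
    rw [hp] at hch
    have hl'v := (mem_leaves.1 hl').1
    have hl'0 : l' ≠ 0 := by
      rintro rfl
      exact CanKill.ne_root hT h (hT.leaf_root hl' hlv)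
    obtain ⟨c, hc, hd⟩ := hT.exists_child hl'v (hT.desc_root l' hl'v) hl'0
    rw [hch, Finset.mem_singleton] at hc
    subst hc
    exact hne (hT.eq_of_desc_leaf hl'v hl hd)
  · apply hT.simple _ (hT.parent_mem l hlv) hp
    rw [hch, Finset.card_singleton]

/-- No inner vertex other than the root loses its second-to-last child, so simplicity persists, and
the removed edge carries no robot. -/
theorem removes_prune (hT : T.IsSimpleTree) {l : ℕ} (h : T.CanKill l)
    (hcase : ¬ (T.parent l ≠ 0 ∧ (T.siblings l).card = 1)) : T.Removes (T.prune l) l := by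
  classical
  have hl := h.1
  have hlv := (mem_leaves.1 hl).1
  have hl0 := CanKill.ne_root hT h
  have hpar : ∀ v, v ≠ l → (T.prune l).parent v = T.parent v := fun v hv => by
    simp [prune, hv]
  have hlen : ∀ v, v ≠ l → (T.prune l).len v = T.len v := fun v hv => by
    simp [prune, hv]
  have hverts : ∀ v, v ∈ (T.prune l).verts ↔ v ≠ l ∧ v ∈ T.verts := fun v => by
    simp [prune]
  have hparmem : ∀ v ∈ (T.prune l).verts, (T.prune l).parent v ∈ (T.prune l).verts := by
    intro v hv
    obtain ⟨hvl, hv⟩ := (hverts v).1 hv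
    rw [hpar v hvl]
    exact (hverts _).2 ⟨parent_ne_leaf hT hl hl0 hv, hT.parent_mem v hv⟩
  have hiter : ∀ n, ∀ v ∈ (T.prune l).verts, (T.prune l).parent^[n] v = T.parent^[n] v := by
    intro n
    induction n with
    | zero => intro v _; rfl
    | succ n ih =>
      intro v hv
      rw [Function.iterate_succ_apply, Function.iterate_succ_apply, ih _ (hparmem v hv),
        hpar v ((hverts v).1 hv).1]
  have hdesc : ∀ v ∈ (T.prune l).verts, ∀ u, (T.prune l).Desc v u ↔ T.Desc v u := by
    intro v hv u
    simp only [Desc, hiter _ v hv]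
  have hchild : ∀ u, (T.prune l).children u = (T.children u).erase l := by
    intro u
    ext c
    rw [mem_children, Finset.mem_erase, mem_children, hverts]
    constructor
    · rintro ⟨h0, ⟨hcl, hc⟩, hp⟩
      exact ⟨hcl, h0, hc, by rwa [hpar c hcl] at hp⟩
    · rintro ⟨hcl, h0, hc, hp⟩
      exact ⟨h0, ⟨hcl, hc⟩, by rwa [hpar c hcl]⟩
  have hmass : ∀ y : ℕ → ℕ, y l = 0 → ∀ u, (T.prune l).mass y u = T.mass y u := by
    intro y hy u
    unfold mass
    rw [Finset.sum_filter, Finset.sum_filter]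
    change ∑ v ∈ T.verts.erase l, _ = _
    rw [← Finset.add_sum_erase T.verts _ hlv, hy]
    simp only [ite_self, zero_add]
    refine Finset.sum_congr rfl fun v hv => ?_
    simp only [hdesc v hv]
  have hsum : ∀ g : ℕ → ℝ, g l = 0 → ∑ u ∈ (T.prune l).verts.erase 0, (T.prune l).len u * g u
      = ∑ u ∈ T.verts.erase 0, T.len u * g u := by
    intro g hg
    rw [← Finset.add_sum_erase (T.verts.erase 0) _ (Finset.mem_erase.2 ⟨hl0, hlv⟩), hg, mul_zero,
      zero_add, Finset.erase_right_comm]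
    refine Finset.sum_congr rfl fun v hv => ?_
    rw [hlen v (Finset.ne_of_mem_erase (Finset.mem_of_mem_erase hv))]
  refine ⟨⟨?_, hparmem, ?_, ?_, ?_, ?_, ?_, ?_⟩, ?_, ?_, ?_, ?_, ?_⟩
  · exact (hverts 0).2 ⟨hl0.symm, hT.root_mem⟩
  · intro u hu
    exact (hdesc u hu 0).2 (hT.desc_root u ((hverts u).1 hu).2)
  · intro u hu hu0
    rw [hlen u ((hverts u).1 hu).1]
    exact hT.len_pos u ((hverts u).1 hu).2 hu0
  · intro u hu hu0
    rw [hchild]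
    by_cases hup : u = T.parent l
    · subst hup
      intro hcard
      exact hcase ⟨hu0, hcard⟩
    · rw [Finset.erase_eq_of_notMem fun hm => hup (mem_children.1 hm).2.2.symm]
      exact hT.simple u ((hverts u).1 hu).2 hu0
  · rw [hpar 0 hl0.symm, hT.parent_root]
  · rw [hlen 0 hl0.symm, hT.len_root]
  · intro u hu
    by_cases hul : u = l
    · simp [prune, hul]
    · rw [hpar u hul, hlen u hul]
      exact hT.off_verts u fun hm => hu ((hverts u).2 ⟨hul, hm⟩)
  · exact Finset.erase_subset _ _
  · exact fun hm => ((hverts l).1 hm).1 rfl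
  · ext u
    rw [mem_leaves, Finset.mem_erase, mem_leaves, hverts, hchild]
    constructor
    · rintro ⟨⟨hul, hu⟩, hc⟩
      refine ⟨hul, hu, ?_⟩
      by_contra hne
      have hmem : l ∈ T.children u := by
        by_contra hm
        rw [Finset.erase_eq_of_notMem hm] at hc
        exact hne hc
      have hup := (mem_children.1 hmem).2.2
      apply CanKill.children_parent_ne hT h
      rw [hup, ← Finset.insert_erase hmem, hc]
      rfl
    · rintro ⟨hul, hu, hc⟩
      exact ⟨⟨hul, hu⟩, by rw [hc]; rfl⟩
  · intro k φ y hφ _ hyl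
    unfold potential
    rw [← hsum (fun u => φ (T.mass y u)) (by simp only [hT.mass_leaf y hl, hyl, hφ])]
    simp only [hmass y hyl]
  · intro k x y _ hxl _ hyl
    unfold OT
    rw [← hsum (fun u => |(T.mass x u : ℝ) - T.mass y u|)
      (by simp only [hT.mass_leaf x hl, hT.mass_leaf y hl, hxl, hyl]; simp)]
    simp only [hmass y hyl, hmass x hxl]

/-- When `l` is empty, the edges of `p` and of the remaining child `b` carry the same robots, so
merging them preserves every sum over edges. -/
theorem removes_splice (hT : T.IsSimpleTree) {l : ℕ} (h : T.CanKill l)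
    (hp0 : T.parent l ≠ 0) (hcard : (T.siblings l).card = 1) : T.Removes (T.splice l) l := by
  classical
  have hl := h.1
  have hlv := (mem_leaves.1 hl).1
  have hl0 := CanKill.ne_root hT h
  obtain ⟨b, hb⟩ := Finset.card_eq_one.1 hcard
  set p := T.parent l with hpdef
  have hpv : p ∈ T.verts := hT.parent_mem l hlv
  have hlp : l ∈ T.children p := mem_children.2 ⟨hl0, hlv, rfl⟩
  have hbmem : b ∈ T.siblings l := by rw [hb]; exact Finset.mem_singleton_self b
  have hbl : b ≠ l := Finset.ne_of_mem_erase hbmem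
  have hbp : b ∈ T.children p := Finset.mem_of_mem_erase hbmem
  obtain ⟨hb0, hbv, hbpar⟩ := mem_children.1 hbp
  have hpl : p ≠ l := parent_ne_leaf hT hl hl0 hlv
  have hself : ∀ v ∈ T.verts, v ≠ 0 → T.parent v ≠ v := by
    intro v hv hv0 heq
    exact hT.not_desc_child (mem_children.2 ⟨hv0, hv, heq⟩) (Desc.refl T v)
  have hbnp : b ≠ p := fun heq => hself p hpv hp0 (heq ▸ hbpar)
  set g := T.parent p with hgdef
  have hgv : g ∈ T.verts := hT.parent_mem p hpv
  have hgp : g ≠ p := hself p hpv hp0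
  have hgl : g ≠ l := parent_ne_leaf hT hl hl0 hpv
  have hchp : T.children p = {l, b} := by
    rw [← Finset.insert_erase hlp]
    exact congrArg (insert l) hb
  have hverts : ∀ v, v ∈ (T.splice l).verts ↔ v ≠ p ∧ v ≠ l ∧ v ∈ T.verts := fun v => by
    simp [splice, ← hpdef]
  have hparb : (T.splice l).parent b = g := by
    simp [splice, ← hpdef, hbl, hbnp, hb, ← hgdef]
  have hlenb : (T.splice l).len b = T.len p + T.len b := by
    simp [splice, ← hpdef, hbl, hbnp, hb]
  have hpar : ∀ v, v ≠ l → v ≠ p → v ≠ b → (T.splice l).parent v = T.parent v := fun v h1 h2 h3 => by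
    simp [splice, ← hpdef, h1, h2, h3, hb]
  have hlen : ∀ v, v ≠ l → v ≠ p → v ≠ b → (T.splice l).len v = T.len v := fun v h1 h2 h3 => by
    simp [splice, ← hpdef, h1, h2, h3, hb]
  have hparp : ∀ v ∈ T.verts, v ≠ l → v ≠ b → T.parent v ≠ p := by
    intro v hv hvl hvb heq
    have hv0 : v ≠ 0 := by
      rintro rfl
      rw [hT.parent_root] at heq
      exact hp0 heq.symm
    have : v ∈ T.children p := mem_children.2 ⟨hv0, hv, heq⟩
    rw [hchp] at this
    simp [hvl, hvb] at this
  have hgmem : g ∈ (T.splice l).verts := (hverts g).2 ⟨hgp, hgl, hgv⟩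
  have hparmem : ∀ v ∈ (T.splice l).verts, (T.splice l).parent v ∈ (T.splice l).verts := by
    intro v hv
    obtain ⟨hvp, hvl, hv⟩ := (hverts v).1 hv
    by_cases hvb : v = b
    · rw [hvb, hparb]; exact hgmem
    · rw [hpar v hvl hvp hvb]
      exact (hverts _).2 ⟨hparp v hv hvl hvb, parent_ne_leaf hT hl hl0 hv, hT.parent_mem v hv⟩
  have hdesc₁ : ∀ v ∈ (T.splice l).verts, ∀ u, (T.splice l).Desc v u → T.Desc v u := by
    rintro v hv u ⟨n, hn⟩
    induction n generalizing v with
    | zero => exact ⟨0, hn⟩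
    | succ n ih =>
      rw [Function.iterate_succ_apply] at hn
      refine Desc.trans ?_ (ih _ (hparmem v hv) hn)
      obtain ⟨hvp, hvl, -⟩ := (hverts v).1 hv
      by_cases hvb : v = b
      · rw [hvb, hparb]
        exact (hbpar ▸ T.desc_parent b : T.Desc b p).trans (T.desc_parent p)
      · rw [hpar v hvl hvp hvb]; exact T.desc_parent v
  -- Strong induction, because the step from `b` to `g` in the new tree stands for two steps in the
  -- old one.
  have hdesc₂ : ∀ n, ∀ v ∈ (T.splice l).verts, ∀ u ∈ (T.splice l).verts, T.parent^[n] v = u →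
      (T.splice l).Desc v u := by
    intro n
    induction n using Nat.strong_induction_on with
    | _ n ih =>
      intro v hv u hu hn
      obtain ⟨hvp, hvl, hvv⟩ := (hverts v).1 hv
      match n, ih, hn with
      | 0, _, hn => exact ⟨0, hn⟩
      | n + 1, ih, hn =>
        rw [Function.iterate_succ_apply] at hn
        by_cases hvb : v = b
        · rw [hvb, hbpar] at hn
          match n, ih, hn with
          | 0, _, hn => exact absurd hn.symm ((hverts u).1 hu).1
          | m + 1, ih, hn =>
            rw [Function.iterate_succ_apply] at hn
            have := ih m (by omega) g hgmem u hu hn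
            rw [hvb]
            exact (hparb ▸ (T.splice l).desc_parent b : (T.splice l).Desc b g).trans this
        · have := ih n (by omega) _ (hparmem v hv) u hu (by rw [hpar v hvl hvp hvb]; exact hn)
          exact ((T.splice l).desc_parent v).trans this
  have hdesc : ∀ v ∈ (T.splice l).verts, ∀ u ∈ (T.splice l).verts,
      ((T.splice l).Desc v u ↔ T.Desc v u) := fun v hv u hu =>
    ⟨hdesc₁ v hv u, fun ⟨n, hn⟩ => hdesc₂ n v hv u hu hn⟩
  have hchild : ∀ u, u ≠ g → u ≠ p → (T.splice l).children u = T.children u := by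
    intro u hug hup
    ext c
    rw [mem_children, mem_children, hverts]
    constructor
    · rintro ⟨h0, ⟨hcp, hcl, hc⟩, hp⟩
      by_cases hcb : c = b
      · rw [hcb, hparb] at hp
        exact absurd hp.symm hug
      · exact ⟨h0, hc, by rwa [hpar c hcl hcp hcb] at hp⟩
    · rintro ⟨h0, hc, hp⟩
      have hcp : c ≠ p := by rintro rfl; exact hug hp.symm
      have hcl : c ≠ l := by rintro rfl; exact hup hp.symm
      have hcb : c ≠ b := by rintro rfl; exact hup (hp.symm.trans hbpar)
      exact ⟨h0, ⟨hcp, hcl, hc⟩, by rwa [hpar c hcl hcp hcb]⟩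
  have hpg : p ∈ T.children g := mem_children.2 ⟨hp0, hpv, rfl⟩
  have hbg : b ∉ T.children g := fun hm => hgp ((mem_children.1 hm).2.2.symm.trans hbpar)
  have hchildg : (T.splice l).children g = insert b ((T.children g).erase p) := by
    ext c
    rw [mem_children, Finset.mem_insert, Finset.mem_erase, mem_children, hverts]
    constructor
    · rintro ⟨h0, ⟨hcp, hcl, hc⟩, hp⟩
      by_cases hcb : c = b
      · exact Or.inl hcb
      · exact Or.inr ⟨hcp, h0, hc, by rwa [hpar c hcl hcp hcb] at hp⟩
    · rintro (rfl | ⟨hcp, h0, hc, hp⟩)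
      · exact ⟨hb0, ⟨hbnp, hbl, hbv⟩, hparb⟩
      · have hcl : c ≠ l := by rintro rfl; exact hgp hp.symm
        have hcb : c ≠ b := by rintro rfl; exact hgp (hp.symm.trans hbpar)
        exact ⟨h0, ⟨hcp, hcl, hc⟩, by rwa [hpar c hcl hcp hcb]⟩
  -- The grandparent exchanges the child `p` for `b`, so its degree is unchanged.
  have hcardg : ((T.splice l).children g).card = (T.children g).card := by
    rw [hchildg, Finset.card_insert_of_notMem fun hm => hbg (Finset.mem_of_mem_erase hm),
      Finset.card_erase_add_one hpg]
  have hpnl : p ∉ T.leaves := fun hm => by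
    rw [(mem_leaves.1 hm).2] at hlp; simp at hlp
  have hmass : ∀ y : ℕ → ℕ, y l = 0 → y p = 0 → ∀ u ∈ (T.splice l).verts,
      (T.splice l).mass y u = T.mass y u := by
    intro y hyl hyp u hu
    unfold mass
    rw [Finset.sum_filter, Finset.sum_filter]
    change ∑ v ∈ (T.verts.erase l).erase p, _ = _
    rw [← Finset.add_sum_erase T.verts _ hlv,
      ← Finset.add_sum_erase (T.verts.erase l) _ (Finset.mem_erase.2 ⟨hpl, hpv⟩), hyl, hyp]
    simp only [ite_self, zero_add]
    refine Finset.sum_congr rfl fun v hv => ?_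
    simp only [hdesc v hv u hu]
  have hmassp : ∀ y : ℕ → ℕ, y l = 0 → y p = 0 → T.mass y p = T.mass y b := by
    intro y hyl hyp
    rw [hT.mass_eq y hpv, hchp, Finset.sum_pair hbl.symm, hT.mass_leaf y hl, hyl, hyp]
    simp
  have hsum : ∀ G : ℕ → ℝ, G l = 0 → G p = G b →
      ∑ u ∈ (T.splice l).verts.erase 0, (T.splice l).len u * G u
        = ∑ u ∈ T.verts.erase 0, T.len u * G u := by
    intro G hGl hGp
    have hb' : b ∈ ((T.verts.erase 0).erase l).erase p :=
      Finset.mem_erase.2 ⟨hbnp, Finset.mem_erase.2 ⟨hbl, Finset.mem_erase.2 ⟨hb0, hbv⟩⟩⟩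
    have hset : (T.splice l).verts.erase 0 = ((T.verts.erase 0).erase l).erase p := by
      change ((T.verts.erase l).erase p).erase 0 = _
      rw [Finset.erase_right_comm, Finset.erase_right_comm (a := l)]
    rw [hset, ← Finset.add_sum_erase (T.verts.erase 0) _ (Finset.mem_erase.2 ⟨hl0, hlv⟩),
      ← Finset.add_sum_erase ((T.verts.erase 0).erase l) _
        (Finset.mem_erase.2 ⟨hpl, Finset.mem_erase.2 ⟨hp0, hpv⟩⟩),
      ← Finset.add_sum_erase _ _ hb', ← Finset.add_sum_erase _ (fun u => T.len u * G u) hb',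
      hGl, hGp, hlenb]
    have : ∑ u ∈ (((T.verts.erase 0).erase l).erase p).erase b, (T.splice l).len u * G u
        = ∑ u ∈ (((T.verts.erase 0).erase l).erase p).erase b, T.len u * G u := by
      refine Finset.sum_congr rfl fun v hv => ?_
      simp only [Finset.mem_erase] at hv
      rw [hlen v hv.2.2.1 hv.2.1 hv.1]
    rw [this]
    ring
  have hconf : ∀ {y : ℕ → ℕ} {k : ℕ}, y ∈ T.configs k → y p = 0 := fun hy => hy.1 p hpnl
  refine ⟨⟨?_, hparmem, ?_, ?_, ?_, ?_, ?_, ?_⟩, ?_, ?_, ?_, ?_, ?_⟩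
  · exact (hverts 0).2 ⟨hp0.symm, hl0.symm, hT.root_mem⟩
  · intro u hu
    exact (hdesc u hu 0 ((hverts 0).2 ⟨hp0.symm, hl0.symm, hT.root_mem⟩)).2
      (hT.desc_root u ((hverts u).1 hu).2.2)
  · intro u hu hu0
    obtain ⟨hup, hul, huv⟩ := (hverts u).1 hu
    by_cases hub : u = b
    · rw [hub, hlenb]
      exact add_pos (hT.len_pos p hpv hp0) (hT.len_pos b hbv hb0)
    · rw [hlen u hul hup hub]
      exact hT.len_pos u huv hu0
  · intro u hu hu0
    obtain ⟨hup, hul, huv⟩ := (hverts u).1 hu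
    by_cases hug : u = g
    · rw [hug, hcardg]
      exact hT.simple g hgv (hug ▸ hu0)
    · rw [hchild u hug hup]
      exact hT.simple u huv hu0
  · rw [hpar 0 hl0.symm hp0.symm hb0.symm, hT.parent_root]
  · rw [hlen 0 hl0.symm hp0.symm hb0.symm, hT.len_root]
  · intro u hu
    by_cases hul : u = l
    · simp [splice, hul]
    by_cases hup : u = p
    · simp [splice, hup, ← hpdef]
    have huv : u ∉ T.verts := fun hm => hu ((hverts u).2 ⟨hup, hul, hm⟩)
    have hub : u ≠ b := by rintro rfl; exact huv hbv
    rw [hpar u hul hup hub, hlen u hul hup hub]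
    exact hT.off_verts u huv
  · exact fun v hv => ((hverts v).1 hv).2.2
  · exact fun hm => ((hverts l).1 hm).2.1 rfl
  · ext u
    rw [mem_leaves, Finset.mem_erase, mem_leaves, hverts]
    by_cases hup : u = p
    · have : ¬ T.children p = ∅ := fun he => by rw [he] at hlp; simp at hlp
      simp [hup, this]
    by_cases hug : u = g
    · have h1 : ¬ T.children g = ∅ := fun he => by rw [he] at hpg; simp at hpg
      have h2 : ¬ (T.splice l).children g = ∅ := by rw [hchildg]; simp
      simp [hug, h1, h2]
    · rw [hchild u hug hup]
      tauto
  · intro k φ y hφ hy hyl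
    unfold potential
    rw [← hsum (fun u => φ (T.mass y u)) (by simp only [hT.mass_leaf y hl, hyl, hφ])
      (by simp only [hmassp y hyl (hconf hy)])]
    refine Finset.sum_congr rfl fun u hu => ?_
    rw [hmass y hyl (hconf hy) u (Finset.mem_of_mem_erase hu)]
  · intro k x y hx hxl hy hyl
    unfold OT
    rw [← hsum (fun u => |(T.mass x u : ℝ) - T.mass y u|)
      (by simp only [hT.mass_leaf x hl, hT.mass_leaf y hl, hxl, hyl]; simp)
      (by simp only [hmassp y hyl (hconf hy), hmassp x hxl (hconf hx)])]
    refine Finset.sum_congr rfl fun u hu => ?_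
    rw [hmass y hyl (hconf hy) u (Finset.mem_of_mem_erase hu),
      hmass x hxl (hconf hx) u (Finset.mem_of_mem_erase hu)]

theorem removes_kill (hT : T.IsSimpleTree) {l : ℕ} (h : T.CanKill l) : T.Removes (T.kill l) l := by
  by_cases hcase : T.parent l ≠ 0 ∧ (T.siblings l).card = 1
  · rw [kill_eq_splice hcase]; exact removes_splice hT h hcase.1 hcase.2
  · rw [kill_eq_prune hcase]; exact removes_prune hT h hcase

theorem Removes.mem_configs {T' : WTree} {l : ℕ} (h : T.Removes T' l) (hl : l ∈ T.leaves)
    {y : ℕ → ℕ} : y ∈ T'.configs k ↔ y ∈ T.configs k ∧ y l = 0 := by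
  simp only [configs, Set.mem_ofPred_eq, h.leaves_eq, Finset.mem_erase, not_and_or, not_not]
  constructor
  · rintro ⟨h0, hs⟩
    have hyl : y l = 0 := h0 l (Or.inl rfl)
    refine ⟨⟨fun u hu => h0 u (Or.inr hu), ?_⟩, hyl⟩
    rw [← Finset.add_sum_erase _ _ hl, hyl, hs, zero_add]
  · rintro ⟨⟨h0, hs⟩, hyl⟩
    refine ⟨?_, ?_⟩
    · rintro u (rfl | hu)
      · exact hyl
      · exact h0 u hu
    · rw [← hs, ← Finset.add_sum_erase _ _ hl, hyl, zero_add]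

/-- A configuration on the new tree has no robot on `l`, so the robot that attraction moves in `T`
starts from a surviving leaf. -/
theorem Removes.attracts {T' : WTree} {l : ℕ} (h : T.Removes T' l) (hl : l ∈ T.leaves)
    (hP : ∀ i ∈ T.leaves, T.Attracts k i) : ∀ i ∈ T'.leaves, T'.Attracts k i := by
  intro i hi y hy hyi
  rw [h.leaves_eq, Finset.mem_erase] at hi
  obtain ⟨hyT, hyl⟩ := (h.mem_configs hl).1 hy
  obtain ⟨j, hj, hji, hyj, hlt⟩ := hP i hi.2 y hyT hyi
  have hjl : j ≠ l := by rintro rfl; omega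
  have hsT := swap_mem hj hi.2 hyj hyT
  have hsl : swap y j i l = 0 := by rw [swap_apply_of_ne hjl.symm hi.1.symm, hyl]
  refine ⟨j, ?_, hji, hyj, ?_⟩
  · rw [h.leaves_eq]; exact Finset.mem_erase.2 ⟨hjl, hj⟩
  · rwa [h.potential_eq k _ _ (phi_zero k) hsT hsl, h.potential_eq k _ _ (phi_zero k) hyT hyl,
      h.OT_eq k _ _ hyT hyl hsT hsl]

end WTree

/-! ### Estimates for the potential and for one-robot changes -/

theorem phi_mono (k : ℕ) {m n : ℕ} (h : m ≤ n) : phi k m ≤ phi k n := by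
  have h' : (m : ℝ) ≤ n := by exact_mod_cast h
  simp only [phi]
  gcongr

theorem phi_add_le {k m : ℕ} (h : m ≤ k) (hk : 2 ≤ k) : phi k m + m ≤ 30 * (k : ℝ) ^ 2 := by
  have h' : (m : ℝ) ≤ k := by exact_mod_cast h
  have hk' : (2 : ℝ) ≤ k := by exact_mod_cast hk
  have hm : (0 : ℝ) ≤ m := Nat.cast_nonneg m
  simp only [phi]
  nlinarith

theorem swap_self {y : ℕ → ℕ} {a : ℕ} (h : 1 ≤ y a) : swap y a a = y := by
  funext v
  unfold swap
  split_ifs with hv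
  · subst hv; omega
  · rfl

/-- The change of potential plus transport on edges that lead to the leaves in `S`, when a robot
moves from `a` to `b`. -/
theorem sum_swap_change {k : ℕ} {y : ℕ → ℕ} {a b : ℕ} (hab : a ≠ b) (ha : 1 ≤ y a)
    (S : Finset ℕ) :
    ∑ s ∈ S, phi k (swap y a b s) + ∑ s ∈ S, |(y s : ℝ) - swap y a b s| - ∑ s ∈ S, phi k (y s)
      = (if a ∈ S then 11 - slope k (y a) else 0) + (if b ∈ S then slope k (y b) + 1 else 0) := by
  rw [← Finset.sum_add_distrib, ← Finset.sum_sub_distrib, ← Finset.sum_ite_eq' S a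
    (fun v => 11 - slope k (y v)), ← Finset.sum_ite_eq' S b (fun v => slope k (y v) + 1),
    ← Finset.sum_add_distrib]
  refine Finset.sum_congr rfl fun v _ => ?_
  by_cases hva : v = a
  · subst hva
    obtain ⟨n, hn⟩ : ∃ n, y v = n + 1 := ⟨y v - 1, by omega⟩
    rw [swap_apply_source hab, hn, Nat.add_sub_cancel, phi_succ]
    simp only [if_true, hab, if_false, slope]
    push_cast
    rw [add_sub_cancel_left, abs_one]
    ring
  · by_cases hvb : v = b
    · subst hvb
      rw [swap_apply_target hab, phi_succ]
      simp only [hva, if_true, if_false]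
      push_cast
      rw [sub_add_cancel_left, abs_neg, abs_one]
      ring
    · rw [swap_apply_of_ne hva hvb]
      simp [hva, hvb]

/-! ### The greedy choice, tie-breaking and fork lengths -/

namespace WTree

variable {T T' : WTree} {k : ℕ}

/-- `x'` minimizes `Ψ + O` among the configurations on `T`, and has the least potential among the
minimizers. -/
def IsBest (T : WTree) (k : ℕ) (O : (ℕ → ℕ) → ℝ) (x' : ℕ → ℕ) : Prop :=
  x' ∈ T.configs k ∧ ∀ z ∈ T.configs k,
    T.potential (phi k) x' + O x' < T.potential (phi k) z + O z ∨
      (T.potential (phi k) x' + O x' = T.potential (phi k) z + O z ∧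
        T.potential (phi k) x' ≤ T.potential (phi k) z)

theorem IsBest.le {O : (ℕ → ℕ) → ℝ} {x' z : ℕ → ℕ} (h : T.IsBest k O x') (hz : z ∈ T.configs k) :
    T.potential (phi k) x' + O x' ≤ T.potential (phi k) z + O z := by
  rcases h.2 z hz with h | h
  · exact h.le
  · exact h.1.le

theorem IsSimpleTree.exists_isBest (hT : T.IsSimpleTree) (k : ℕ) (O : (ℕ → ℕ) → ℝ) :
    ∃ x', T.IsBest k O x' := by
  obtain ⟨l, hl⟩ := hT.leaves_nonempty
  obtain ⟨x₀, hx₀, hmin₀⟩ := Set.exists_min_image (T.configs k)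
    (fun z => T.potential (phi k) z + O z) (T.configs_finite k) ⟨_, single_mem_configs hl k⟩
  -- A second minimization, over the finitely many minimizers, selects one of least potential.
  obtain ⟨x₁, ⟨hx₁, heq⟩, hmin₁⟩ := Set.exists_min_image
    {z | z ∈ T.configs k ∧ T.potential (phi k) z + O z = T.potential (phi k) x₀ + O x₀}
    (T.potential (phi k)) ((T.configs_finite k).subset fun _ h => h.1) ⟨x₀, hx₀, rfl⟩
  refine ⟨x₁, hx₁, fun z hz => ?_⟩
  rw [heq]
  rcases (hmin₀ z hz).lt_or_eq with h | h
  · exact Or.inl h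
  · exact Or.inr ⟨h, hmin₁ z ⟨hz, h.symm⟩⟩

/-- If `z` is no worse than staying at `x'`, then by the triangle inequality `z` is a minimizer too,
with potential lower by at least the transport. Least potential makes that transport vanish. -/
theorem IsBest.strictlyStable (hT : T.IsSimpleTree) {O : (ℕ → ℕ) → ℝ} {x' : ℕ → ℕ}
    (h : T.IsBest k O x') (hO : ∀ z ∈ T.configs k, O z ≤ O x' + T.OT x' z) :
    T.StrictlyStable k x' := by
  intro z hz hne
  by_contra hcon
  push Not at hcon
  have hOz := hO z hz
  have hnn := hT.OT_nonneg x' z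
  rcases h.2 z hz with h' | ⟨-, h'⟩
  · linarith
  · exact hne (hT.eq_of_OT_eq_zero h.1 hz (by linarith)).symm

theorem StrictlyStable.eq_of_isBest {x x' : ℕ → ℕ} (h : T.StrictlyStable k x)
    (hx : x ∈ T.configs k) (hb : T.IsBest k (T.OT x) x') : x' = x := by
  by_contra hne
  have h1 := h x' hb.1 hne
  have h2 := hb.le hx
  rw [OT_self] at h2
  linarith

open Classical in
/-- The cost of the transport from `x` to a configuration on `T'`: it takes place in `T` if `T'`
arises by a kill, and in `T'` otherwise. -/
noncomputable def transport (T : WTree) (x : ℕ → ℕ) (T' : WTree) (z : ℕ → ℕ) : ℝ :=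
  if ∃ l, T.CanKill l ∧ T' = T.kill l then T.OT x z else T'.OT x z

theorem IsSimpleTree.transport_self (hT : T.IsSimpleTree) (x : ℕ → ℕ) :
    T.transport x T = T.OT x := by
  funext z
  refine if_neg ?_
  rintro ⟨l, hl, heq⟩
  apply (removes_kill hT hl).notMem
  rw [← heq]
  exact (mem_leaves.1 hl.1).1

theorem transport_kill {l : ℕ} (h : T.CanKill l) (x : ℕ → ℕ) :
    T.transport x (T.kill l) = T.OT x := by
  funext z
  exact if_pos ⟨l, h, rfl⟩

/-- A fork adds vertices and a kill only removes some, so the two kinds of successor trees cannot be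
confused. -/
theorem IsSimpleTree.transport_fork (hT : T.IsSimpleTree) {x : ℕ → ℕ} {f : ℕ} {S : Finset ℕ}
    (h : T.CanFork x f S) (δ : ℝ) :
    T.transport x (T.fork f S δ) = (T.fork f S δ).OT x := by
  funext z
  refine if_neg ?_
  rintro ⟨l, hl, heq⟩
  obtain ⟨s, hs⟩ : S.Nonempty := Finset.card_pos.1 (by have := h.2.2.1; omega)
  have hmem : s ∈ (T.kill l).verts := heq ▸ mem_fork_verts.2 (Or.inr hs)
  exact Finset.disjoint_left.1 h.2.1 hs ((removes_kill hT hl).verts_subset hmem)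

/-- A length of the new edges that is so small that no robot profits from the fork. -/
def SmallLength (T : WTree) (k : ℕ) (x : ℕ → ℕ) (δ : ℝ) : Prop :=
  (∀ z ∈ T.configs k, z ≠ x →
    T.potential (phi k) x + δ * (30 * (k : ℝ) ^ 2) < T.potential (phi k) z + T.OT x z) ∧
  ∀ f ∈ T.leaves, f ≠ 0 → δ * (30 * (k : ℝ) ^ 2) < T.len f

-- The conditions are finitely many strict inequalities that hold at `δ = 0`.
open Filter Topology in
theorem IsSimpleTree.exists_smallLength (hT : T.IsSimpleTree) {x : ℕ → ℕ}
    (hs : T.StrictlyStable k x) : ∃ δ, 0 < δ ∧ δ < 1 ∧ T.SmallLength k x δ := by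
  have key : ∀ a b : ℝ, a < b → ∀ᶠ δ in 𝓝[>] (0 : ℝ), a + δ * (30 * (k : ℝ) ^ 2) < b := by
    intro a b hab
    have hc : Continuous fun δ : ℝ => a + δ * (30 * (k : ℝ) ^ 2) := by fun_prop
    have ht := hc.tendsto' 0 a (by ring)
    exact (ht.eventually_lt_const hab).filter_mono nhdsWithin_le_nhds
  have h1 : ∀ᶠ δ in 𝓝[>] (0 : ℝ), ∀ z ∈ T.configs k, z ≠ x →
      T.potential (phi k) x + δ * (30 * (k : ℝ) ^ 2) < T.potential (phi k) z + T.OT x z := by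
    rw [Filter.eventually_all_finite (T.configs_finite k)]
    intro z hz
    by_cases hzx : z = x
    · exact Filter.Eventually.of_forall fun _ h => absurd hzx h
    · filter_upwards [key _ _ (hs z hz hzx)] with δ h _ using h
  have h2 : ∀ᶠ δ in 𝓝[>] (0 : ℝ), ∀ f ∈ T.leaves, f ≠ 0 →
      δ * (30 * (k : ℝ) ^ 2) < T.len f := by
    rw [Filter.eventually_all_finset]
    intro f hf
    by_cases hf0 : f = 0
    · exact Filter.Eventually.of_forall fun _ h => absurd hf0 h
    · filter_upwards [key 0 _ (hT.len_pos f (mem_leaves.1 hf).1 hf0)] with δ h _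
      linarith
  have h3 : ∀ᶠ δ in 𝓝[>] (0 : ℝ), δ < 1 :=
    (eventually_lt_nhds zero_lt_one).filter_mono nhdsWithin_le_nhds
  obtain ⟨δ, h1, h2, h3, h4⟩ := (h1.and (h2.and (h3.and self_mem_nhdsWithin))).exists
  exact ⟨δ, h4, h3, h1, h2⟩

end WTree

open WTree

open Classical in
/-- The greedy strategy, with ties broken in favor of a small potential and tiny fork lengths. -/
noncomputable def greedy (k : ℕ) : Strategy k where
  -- The default `x` is used only if `T'` is not a simple tree, and the default `1 / 2` below only
  -- if no small length exists, which strict stability on a simple tree rules out.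
  move T x T' := if h : ∃ x', T'.IsBest k (T.transport x T') x' then h.choose else x
  forkLength T x _ _ :=
    if h : ∃ δ, 0 < δ ∧ δ < 1 ∧ T.SmallLength k x δ then h.choose else 1 / 2
  move_mem := by
    intro T x T' _ _ hT'
    have h := hT'.exists_isBest k (T.transport x T')
    rw [dif_pos h]
    exact h.choose_spec.1
  forkLength_pos := by
    intro T x _ _
    split_ifs with h
    · exact h.choose_spec.1
    · norm_num
  forkLength_lt_one := by
    intro T x _ _
    split_ifs with h
    · exact h.choose_spec.2.1
    · norm_num

section Greedy

variable {T : WTree} {k : ℕ} {x : ℕ → ℕ}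

theorem greedy_move_isBest {T' : WTree} (hT' : T'.IsSimpleTree) :
    T'.IsBest k (T.transport x T') ((greedy k).move T x T') := by
  have h := hT'.exists_isBest k (T.transport x T')
  have : (greedy k).move T x T' = h.choose := dif_pos h
  rw [this]
  exact h.choose_spec

theorem greedy_respond_isBest (hT : T.IsSimpleTree) :
    T.IsBest k (T.OT x) ((greedy k).respond T x) := by
  have := greedy_move_isBest (k := k) (T := T) (x := x) hT
  rwa [hT.transport_self] at this

theorem greedy_respond_strictlyStable (hT : T.IsSimpleTree) :
    T.StrictlyStable k ((greedy k).respond T x) :=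
  (greedy_respond_isBest hT).strictlyStable hT fun z _ => hT.OT_triangle _ _ z

theorem greedy_respond_eq_self (hT : T.IsSimpleTree) (hx : x ∈ T.configs k)
    (hs : T.StrictlyStable k x) : (greedy k).respond T x = x :=
  hs.eq_of_isBest hx (greedy_respond_isBest hT)

theorem greedy_smallLength (hT : T.IsSimpleTree) (hs : T.StrictlyStable k x) (l m : ℕ) :
    T.SmallLength k x ((greedy k).forkLength T x l m) := by
  have h := hT.exists_smallLength hs
  have : (greedy k).forkLength T x l m = h.choose := dif_pos h
  rw [this]
  exact h.choose_spec.2.2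

theorem greedy_isGreedy (k : ℕ) : (greedy k).IsGreedy (phi k) where
  stay := fun T x hT _ z hz => (greedy_respond_isBest hT).le hz
  -- Choosing the least potential among minimizers makes every response strictly stable; staying put
  -- is therefore possible only without a tie.
  ties := by
    intro T x hT _ heq
    have := greedy_respond_strictlyStable (k := k) (x := x) hT
    rwa [heq] at this
  fork := by
    intro T x l S δ hT _ hF hδ _ z hz
    have := greedy_move_isBest (k := k) (T := T) (x := x)
      (hT.fork hF.2.1 hF.1 hF.2.2.1 hδ)
    rw [hT.transport_fork hF] at this
    exact this.le hz
  kill := by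
    intro T x l hT _ hK z hz
    have := greedy_move_isBest (k := k) (T := T) (x := x) (removes_kill hT hK).isSimple
    rw [transport_kill hK] at this
    exact this.le hz

/-! ### The invariant at the start and during elongations -/

/-- What holds in every state that can be reached against the greedy strategy. -/
structure Invariant (k : ℕ) (T : WTree) (x : ℕ → ℕ) (c : ℝ) : Prop where
  isSimple : T.IsSimpleTree
  config : x ∈ T.configs k
  strict : T.StrictlyStable k x
  bound : ∀ z ∈ T.configs k, c + T.potential (phi k) x ≤ 21 * T.potential (phi k) z
  attracts : ∀ l ∈ T.leaves, T.Attracts k l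

/-- There is only one configuration, and it leaves no leaf empty, so stability and attraction are
vacuous. -/
theorem Invariant.start (hk : 2 ≤ k) (hT : T.IsSimpleTree) {l : ℕ} (hl : T.leaves = {l}) :
    Invariant k T (Pi.single l k) 0 := by
  have huniq : ∀ z ∈ T.configs k, z = Pi.single l k := by
    intro z hz
    have hs := hz.2
    rw [hl, Finset.sum_singleton] at hs
    funext u
    by_cases hu : u = l
    · rw [hu, hs, Pi.single_eq_same]
    · rw [Pi.single_eq_of_ne hu]
      exact hz.1 u (by rw [hl]; simpa using hu)
  refine ⟨hT, single_mem_configs (by rw [hl]; simp) k, fun z hz hne => absurd (huniq z hz) hne,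
    fun z hz => ?_, fun i hi y hy hyi => ?_⟩
  · rw [huniq z hz]
    have := hT.potential_nonneg (k := k) (Pi.single l k)
    linarith
  · rw [hl, Finset.mem_singleton] at hi
    rw [huniq y hy, hi, Pi.single_eq_same] at hyi
    omega

theorem Invariant.wait {c : ℝ} (h : Invariant k T x c) :
    Invariant k T ((greedy k).respond T x) (c + T.OT x ((greedy k).respond T x)) := by
  rw [greedy_respond_eq_self h.isSimple h.config h.strict, OT_self, add_zero]
  exact h

theorem nonpos_of_forall_lt {a b s : ℝ} (hs : 0 < s)
    (h : ∀ t, 0 ≤ t → t < s → a + t * b ≤ 0) : a + s * b ≤ 0 := by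
  by_contra hcon
  push Not at hcon
  have ha : a ≤ 0 := by simpa using h 0 le_rfl hs
  have hb : 0 < b := by
    by_contra hb
    push Not at hb
    nlinarith
  have hε : 0 < (a + s * b) / (2 * b) := by positivity
  have hle : (a + s * b) / (2 * b) ≤ s := by
    rw [div_le_iff₀ (by positivity)]
    nlinarith
  -- At this time, before `s`, the affine function has half its value at `s`, which is still
  -- positive.
  have := h (s - (a + s * b) / (2 * b)) (by linarith) (by linarith)
  have heq : (a + s * b) / (2 * b) * b = (a + s * b) / 2 := by field_simp
  nlinarith

/-- The advantage of `z` over staying at `x` is affine in the elongation time. -/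
theorem elongate_excess (hT : T.IsSimpleTree) {l : ℕ} (hl : l ∈ T.leaves) (hl0 : l ≠ 0) (t : ℝ)
    (z : ℕ → ℕ) :
    (T.elongate l t).potential (phi k) x
        - ((T.elongate l t).potential (phi k) z + (T.elongate l t).OT x z)
      = (T.potential (phi k) x - (T.potential (phi k) z + T.OT x z))
        + t * (phi k (x l) - (phi k (z l) + |(x l : ℝ) - z l|)) := by
  rw [hT.potential_elongate hl hl0, hT.potential_elongate hl hl0, hT.OT_elongate hl hl0]
  ring

/-- Stability holds before time `s` because the greedy rule stays; being a closed condition, it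
passes to the limit `s`, although strictness may be lost. -/
theorem stable_elongate_of_quiet (hT : T.IsSimpleTree) {l : ℕ} (hl : l ∈ T.leaves) (hl0 : l ≠ 0)
    {s : ℝ} (hs : 0 < s) (hq : (greedy k).QuietUntil T x l s) : (T.elongate l s).Stable k x := by
  intro z hz
  have key := nonpos_of_forall_lt (a := T.potential (phi k) x - (T.potential (phi k) z + T.OT x z))
    (b := phi k (x l) - (phi k (z l) + |(x l : ℝ) - z l|)) hs (fun t ht hts => by
      rw [← elongate_excess hT hl hl0]
      have hb := greedy_respond_isBest (k := k) (x := x) (hT.elongate (mem_leaves.1 hl).1 hl0 ht)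
      rw [hq t ht hts] at hb
      have := hb.le hz
      rw [OT_self] at this
      linarith)
  rw [← elongate_excess hT hl hl0] at key
  linarith

theorem Invariant.elongate (hk : 2 ≤ k) {c : ℝ} (h : Invariant k T x c) {l : ℕ}
    (hE : T.CanElongate x l) {s : ℝ} (hs : 0 < s) (hq : (greedy k).QuietUntil T x l s) :
    Invariant k (T.elongate l s) ((greedy k).respond (T.elongate l s) x)
      (c + s * x l + (T.elongate l s).OT x ((greedy k).respond (T.elongate l s) x)) := by
  obtain ⟨hl, hl0, hxl⟩ := hE
  have hT := h.isSimple
  have hT' := hT.elongate (mem_leaves.1 hl).1 hl0 hs.le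
  have hst := stable_elongate_of_quiet hT hl hl0 hs hq
  have hbest := greedy_respond_isBest (k := k) (x := x) hT'
  refine ⟨hT', hbest.1, greedy_respond_strictlyStable hT', ?_,
    hT.attracts_elongate hk h.config hl hl0 hxl hs.le hst h.attracts⟩
  obtain ⟨z₀, hz₀, hmin⟩ := Set.exists_min_image ((T.elongate l s).configs k)
    ((T.elongate l s).potential (phi k)) ((T.elongate l s).configs_finite k) ⟨x, h.config⟩
  -- Otherwise stability of `x` in the elongated tree would produce a configuration better than the
  -- minimizer `z₀`.
  have hz₀l : x l ≤ z₀ l + 1 := by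
    by_contra hcon
    obtain ⟨j, hj, -, hyj, -, hgain⟩ := hT'.exists_gain hk h.config hz₀ hst hl (by omega)
    have h1 := hmin _ (swap_mem hj hl hyj hz₀)
    have h2 := hT'.OT_nonneg z₀ (swap z₀ j l)
    have h3 := hT'.len_pos l (mem_leaves.1 hl).1 hl0
    linarith
  intro z hz
  have h1 := hbest.le (z := x) h.config
  rw [OT_self, add_zero, hT.potential_elongate hl hl0 s _ x] at h1
  have h2 := h.bound z₀ hz₀
  have h3 := hmin z hz
  rw [hT.potential_elongate hl hl0 s _ z₀] at h3
  -- Since `x l ≥ 2`, the minimizer has at least one robot on `l`; this uses that a leaf with a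
  -- single robot cannot be elongated.
  have h4 : phi k (x l) + x l ≤ 21 * phi k (z₀ l) := by
    have hx2 : (2 : ℝ) ≤ x l := by exact_mod_cast hxl
    have hz1 : (x l : ℝ) ≤ z₀ l + 1 := by exact_mod_cast hz₀l
    have hk' : (2 : ℝ) ≤ k := by exact_mod_cast hk
    have hxk : (x l : ℝ) ≤ k := by exact_mod_cast hT.apply_le h.config l
    simp only [phi]
    nlinarith [mul_le_mul_of_nonneg_left hz1 (show (0 : ℝ) ≤ 20 * k by linarith), sq_nonneg (z₀ l : ℝ)]
  have h5 := mul_le_mul_of_nonneg_left h4 hs.le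
  linarith

end Greedy

/-! ### Attraction after a fork -/

namespace WTree

section Fork

variable {T : WTree} {k : ℕ} {f : ℕ} {S : Finset ℕ} {δ : ℝ}

/-- The change of potential plus transport when one robot moves in a forked tree. -/
theorem IsSimpleTree.fork_swap_change (hT : T.IsSimpleTree) (hS : Disjoint S T.verts)
    (hf : f ∈ T.leaves) (hcard : 2 ≤ S.card) (hδ : 0 < δ) {y : ℕ → ℕ} {a b : ℕ} (hab : a ≠ b)
    (ha : 1 ≤ y a) {z : ℕ → ℕ}
    (hz : z = swap (proj f S y) (if a ∈ S then f else a) (if b ∈ S then f else b)) :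
    (T.fork f S δ).potential (phi k) (swap y a b) + (T.fork f S δ).OT y (swap y a b)
        - (T.fork f S δ).potential (phi k) y
      = T.potential (phi k) z + T.OT (proj f S y) z - T.potential (phi k) (proj f S y)
        + δ * ((if a ∈ S then 11 - slope k (y a) else 0)
          + (if b ∈ S then slope k (y b) + 1 else 0)) := by
  rw [hT.fork_potential hS hf hcard hδ, hT.fork_potential hS hf hcard hδ,
    hT.fork_OT hS hf hcard hδ, proj_swap (notMem_of_mem_leaves hS hf) ha, ← hz,
    ← sum_swap_change hab ha S]
  ring

theorem IsSimpleTree.fork_config_apply (hT : T.IsSimpleTree) (hS : Disjoint S T.verts)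
    (hf : f ∈ T.leaves) (hne : S.Nonempty) {y : ℕ → ℕ} (hy : y ∈ (T.fork f S δ).configs k) :
    y f = 0 := by
  refine hy.1 f ?_
  rw [hT.fork_leaves hS hf hne]
  simp [notMem_of_mem_leaves hS hf]

theorem IsSimpleTree.attracts_fork (hT : T.IsSimpleTree) (hk : 2 ≤ k) {x : ℕ → ℕ}
    (hx : x ∈ T.configs k) (hst : T.Stable k x) (hF : T.CanFork x f S) (hδ : 0 < δ)
    (hsmall : f ≠ 0 → δ * (30 * (k : ℝ) ^ 2) < T.len f) (hP : ∀ i ∈ T.leaves, T.Attracts k i) :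
    ∀ i ∈ (T.fork f S δ).leaves, (T.fork f S δ).Attracts k i := by
  obtain ⟨hf, hS, hcard, hxf⟩ := hF
  have hne : S.Nonempty := Finset.card_pos.1 (by omega)
  have hL := hT.fork_leaves (δ := δ) hS hf hne
  have hk' : (2 : ℝ) ≤ k := by exact_mod_cast hk
  intro i hi y hy hyi
  have hyf := hT.fork_config_apply hS hf hne hy
  have hz := hT.proj_mem hS hf hne hy
  have hzf : proj f S y f = ∑ s ∈ S, y s := by simp [proj, hyf]
  have hold : ∀ v ∈ T.leaves, v ≠ f → proj f S y v = y v := fun v hv hvf => by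
    simp [proj, hvf, notMem_of_mem_leaves hS hv]
  rw [hL, Finset.mem_union, Finset.mem_erase] at hi
  rcases hi with ⟨hif, hi⟩ | hi
  · have hiS := notMem_of_mem_leaves hS hi
    obtain ⟨j, hj, hji, hzj, hlt⟩ := hP i hi _ hz (by rw [hold i hi hif, hyi])
    by_cases hjf : j = f
    · subst hjf
      obtain ⟨s, hs, hys⟩ : ∃ s ∈ S, y s ≠ 0 := by
        by_contra hcon
        push Not at hcon
        rw [hzf, Finset.sum_eq_zero hcon] at hzj
        omega
      have hsi : s ≠ i := by rintro rfl; exact hiS hs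
      refine ⟨s, by rw [hL]; exact Finset.mem_union_right _ hs, hsi, by omega, ?_⟩
      have key := hT.fork_swap_change (k := k) hS hf hcard hδ (y := y) hsi (by omega)
        (z := swap (proj j S y) j i) (by simp [hs, hiS])
      simp only [hs, hiS, if_true, if_false, slope] at key
      have : 0 ≤ δ * (20 * (k : ℝ) + 10 * (y s) + 5 - 11) :=
        mul_nonneg hδ.le (by have : (0 : ℝ) ≤ y s := Nat.cast_nonneg _; linarith)
      linarith
    · have hjS := notMem_of_mem_leaves hS hj
      rw [hold j hj hjf] at hzj
      refine ⟨j, by rw [hL]; exact Finset.mem_union_left _ (Finset.mem_erase.2 ⟨hjf, hj⟩), hji,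
        hzj, ?_⟩
      have key := hT.fork_swap_change (k := k) hS hf hcard hδ (y := y) hji hzj
        (z := swap (proj f S y) j i) (by simp [hjS, hiS])
      simp only [hjS, hiS, if_false] at key
      linarith
  -- The leaf `i` is new. If `y` has at least two robots fewer than `x` in the whole fork, a robot
  -- is fetched from outside; the gain `4 d_f` exceeds what a new edge of length `δ` costs.
  · by_cases hgap : proj f S y f + 2 ≤ x f
    · obtain ⟨j, hj, hjf, hzj, hf0, hgain⟩ := hT.exists_gain hk hx hz hst hf hgap
      have hjS := notMem_of_mem_leaves hS hj
      rw [hold j hj hjf] at hzj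
      have hji : j ≠ i := by rintro rfl; exact hjS hi
      refine ⟨j, by rw [hL]; exact Finset.mem_union_left _ (Finset.mem_erase.2 ⟨hjf, hj⟩), hji,
        hzj, ?_⟩
      have key := hT.fork_swap_change (k := k) hS hf hcard hδ (y := y) hji hzj
        (z := swap (proj f S y) j f) (by simp [hjS, hi])
      simp only [hjS, hi, if_true, if_false, slope, hyi, Nat.cast_zero] at key
      have h1 := hsmall hf0
      have h2 : δ * (20 * (k : ℝ) + 10 * 0 + 5 + 1) ≤ δ * (30 * (k : ℝ) ^ 2) :=
        mul_le_mul_of_nonneg_left (by nlinarith) hδ.le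
      have h3 := hT.len_pos f (mem_leaves.1 hf).1 hf0
      linarith
    -- Pigeonhole: at least `x f - 1 ≥ S.card` robots sit on the new leaves and `i` is empty, so
    -- some new leaf has two. Moving one of them to `i` changes potential plus transport by at most
    -- `-8 δ`.
    · obtain ⟨s, hs, hys⟩ : ∃ s ∈ S, 2 ≤ y s := by
        by_contra hcon
        push Not at hcon
        have h1 : ∑ s ∈ S.erase i, y s ≤ ∑ _s ∈ S.erase i, 1 :=
          Finset.sum_le_sum fun s hs => by
            have := hcon s (Finset.mem_of_mem_erase hs)
            omega
        rw [Finset.sum_const, smul_eq_mul, mul_one, Finset.card_erase_of_mem hi] at h1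
        have h2 := Finset.add_sum_erase S y hi
        omega
      have hsi : s ≠ i := by rintro rfl; omega
      refine ⟨s, by rw [hL]; exact Finset.mem_union_right _ hs, hsi, by omega, ?_⟩
      have key := hT.fork_swap_change (k := k) hS hf hcard hδ (y := y) hsi (by omega)
        (z := proj f S y) (by
          simp only [hs, hi, if_true]
          rw [swap_self]
          omega)
      simp only [hs, hi, if_true, slope, hyi, Nat.cast_zero, OT_self] at key
      have h1 : (2 : ℝ) ≤ y s := by exact_mod_cast hys
      nlinarith

end Fork

end WTree

/-! ### The invariant under forks and kills -/

section Game

variable {T : WTree} {k : ℕ} {x : ℕ → ℕ}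

theorem greedy_fork_isBest (hT : T.IsSimpleTree) {f : ℕ} {S : Finset ℕ} (hF : T.CanFork x f S)
    {δ : ℝ} (hδ : 0 < δ) :
    (T.fork f S δ).IsBest k ((T.fork f S δ).OT x) ((greedy k).move T x (T.fork f S δ)) := by
  have := greedy_move_isBest (k := k) (T := T) (x := x) (hT.fork hF.2.1 hF.1 hF.2.2.1 hδ)
  rwa [hT.transport_fork hF] at this

/-- The competitor `lift` sends all robots of `f` to a single new leaf. -/
theorem greedy_fork_le (hT : T.IsSimpleTree) (hx : x ∈ T.configs k) {f : ℕ}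
    {S : Finset ℕ} (hF : T.CanFork x f S) {δ : ℝ} (hδ : 0 < δ) :
    (T.fork f S δ).potential (phi k) ((greedy k).move T x (T.fork f S δ))
        + (T.fork f S δ).OT x ((greedy k).move T x (T.fork f S δ))
      ≤ T.potential (phi k) x + δ * (phi k (x f) + x f) := by
  obtain ⟨hf, hS, hcard, hxf⟩ := hF
  obtain ⟨s, hs⟩ : S.Nonempty := Finset.card_pos.1 (by omega)
  obtain ⟨hmem, hproj, hself, hzero⟩ := hT.lift_mem (δ := δ) hS hf hs hx
  have h := greedy_fork_isBest (k := k) hT (x := x) ⟨hf, hS, hcard, hxf⟩ hδ |>.le hmem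
  have h0 : ∀ s ∈ S, x s = 0 := fun s hs => hx.1 s fun h => notMem_of_mem_leaves hS h hs
  rw [hT.fork_potential hS hf hcard hδ _ (lift f s x), hT.fork_OT hS hf hcard hδ x (lift f s x),
    hproj, proj_of_config hS hx, OT_self,
    Finset.sum_eq_single s (fun b hb hne => by rw [hzero b hb hne, phi_zero])
      (fun h => absurd hs h),
    Finset.sum_eq_single s (fun b hb hne => by rw [hzero b hb hne, h0 b hb]; simp)
      (fun h => absurd hs h), hself, h0 s hs, Nat.cast_zero, zero_sub, abs_neg,
    Nat.abs_cast] at h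
  linarith

/-- Any other distribution among the old leaves loses, by strict stability, more than the at most
`30 k² δ` that the competitor in `greedy_fork_le` costs. -/
theorem greedy_fork_proj (hk : 2 ≤ k) (hT : T.IsSimpleTree) (hx : x ∈ T.configs k) {f : ℕ}
    {S : Finset ℕ} (hF : T.CanFork x f S) {δ : ℝ} (hδ : 0 < δ) (hsmall : T.SmallLength k x δ) :
    proj f S ((greedy k).move T x (T.fork f S δ)) = x := by
  have h1 := greedy_fork_le hT hx hF hδ
  have hbest := greedy_fork_isBest (k := k) hT (x := x) hF hδ
  obtain ⟨hf, hS, hcard, hxf⟩ := hF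
  have hne : S.Nonempty := Finset.card_pos.1 (by omega)
  by_contra hcon
  have h2 := hsmall.1 _ (hT.proj_mem hS hf hne hbest.1) hcon
  have h3 := mul_le_mul_of_nonneg_left (phi_add_le (hT.apply_le hx f) hk) hδ.le
  rw [hT.fork_potential hS hf hcard hδ, hT.fork_OT hS hf hcard hδ, proj_of_config hS hx] at h1
  have h4 : 0 ≤ δ * ∑ s ∈ S, phi k ((greedy k).move T x (T.fork f S δ) s) :=
    mul_nonneg hδ.le (Finset.sum_nonneg fun s _ => phi_nonneg k _)
  have h5 : 0 ≤ δ * ∑ s ∈ S, |(x s : ℝ) - (greedy k).move T x (T.fork f S δ) s| :=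
    mul_nonneg hδ.le (Finset.sum_nonneg fun s _ => abs_nonneg _)
  linarith

theorem greedy_fork_keeps (hk : 2 ≤ k) (hT : T.IsSimpleTree) (hx : x ∈ T.configs k) {f : ℕ}
    {S : Finset ℕ} (hF : T.CanFork x f S) {δ : ℝ} (hδ : 0 < δ) (hsmall : T.SmallLength k x δ)
    {u : ℕ} (hu : u ∈ T.leaves) (huf : u ≠ f) :
    (greedy k).move T x (T.fork f S δ) u = x u := by
  have h := congrFun (greedy_fork_proj hk hT hx hF hδ hsmall) u
  simpa [proj, huf, notMem_of_mem_leaves hF.2.1 hu] using h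

theorem linear_le_phi (k m : ℕ) : 20 * (k : ℝ) * m ≤ phi k m := by
  simp only [phi]
  nlinarith [sq_nonneg (m : ℝ)]

theorem Invariant.fork (hk : 2 ≤ k) {c : ℝ} (h : Invariant k T x c) {f : ℕ} {S : Finset ℕ}
    (hF : T.CanFork x f S) {δ : ℝ} (hδ : 0 < δ) (hsmall : T.SmallLength k x δ) :
    Invariant k (T.fork f S δ) ((greedy k).move T x (T.fork f S δ))
      (c + (T.fork f S δ).OT x ((greedy k).move T x (T.fork f S δ))) := by
  have hT := h.isSimple
  have hle := greedy_fork_le hT h.config hF hδ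
  have hbest := greedy_fork_isBest (k := k) hT (x := x) hF hδ
  have hattr := hT.attracts_fork hk h.config h.strict.stable hF hδ (hsmall.2 f hF.1) h.attracts
  obtain ⟨hf, hS, hcard, hxf⟩ := hF
  have hT' := hT.fork hS hf hcard hδ
  have hne : S.Nonempty := Finset.card_pos.1 (by omega)
  refine ⟨hT', hbest.1, hbest.strictlyStable hT' fun z _ => hT'.OT_triangle _ _ z, ?_, hattr⟩
  intro z hz
  have hzT := hT.proj_mem hS hf hne hz
  have hk' : (2 : ℝ) ≤ k := by exact_mod_cast hk
  have hsum : 20 * (k : ℝ) * proj f S z f ≤ ∑ s ∈ S, phi k (z s) := by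
    have hzf : proj f S z f = ∑ s ∈ S, z s := by simp [proj, hT.fork_config_apply hS hf hne hz]
    rw [hzf, Nat.cast_sum, Finset.mul_sum]
    exact Finset.sum_le_sum fun s _ => linear_le_phi k _
  rw [hT.fork_potential hS hf hcard hδ _ z]
  -- If `z` has few robots in the fork, another configuration of the old tree beats it by `4 d_f`,
  -- more than the fork costs. Otherwise `z` itself pays at least `20 k (x f - 1) δ` on the new
  -- edges, and `x f ≥ 3`.
  by_cases hgap : proj f S z f + 2 ≤ x f
  · obtain ⟨j, hj, -, hzj, hf0, hgain⟩ := hT.exists_gain hk h.config hzT h.strict.stable hf hgap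
    have h1 := h.bound _ (swap_mem hj hf hzj hzT)
    have h2 := hT.OT_nonneg (proj f S z) (swap (proj f S z) j f)
    have h3 := hsmall.2 f hf hf0
    have h4 := mul_le_mul_of_nonneg_left (phi_add_le (hT.apply_le h.config f) hk) hδ.le
    have h5 : 0 ≤ δ * ∑ s ∈ S, phi k (z s) :=
      mul_nonneg hδ.le (Finset.sum_nonneg fun s _ => phi_nonneg k _)
    have h6 := hT.len_pos f (mem_leaves.1 hf).1 hf0
    linarith
  · have h1 := h.bound _ hzT
    have h2 : phi k (x f) + x f ≤ 21 * (20 * (k : ℝ) * proj f S z f) := by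
      have hx3 : (3 : ℝ) ≤ x f := by exact_mod_cast (by omega : 3 ≤ x f)
      have hz1 : (x f : ℝ) ≤ proj f S z f + 1 := by
        exact_mod_cast (by omega : x f ≤ proj f S z f + 1)
      have hxk : (x f : ℝ) ≤ k := by exact_mod_cast hT.apply_le h.config f
      have hm := mul_le_mul_of_nonneg_left hz1 (show (0 : ℝ) ≤ 20 * k by linarith)
      simp only [phi]
      nlinarith
    have h3 := mul_le_mul_of_nonneg_left h2 hδ.le
    have h4 := mul_le_mul_of_nonneg_left hsum hδ.le
    linarith

/-- Evacuation costs at most `21 (Ψ(y) - Ψ(z))`; adding the invariant at `z` leaves exactly the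
invariant at `y`. -/
theorem Invariant.kill (hk : 2 ≤ k) {c : ℝ} (h : Invariant k T x c) {l : ℕ} (hK : T.CanKill l) :
    Invariant k (T.kill l) ((greedy k).move T x (T.kill l))
      (c + T.OT x ((greedy k).move T x (T.kill l))) := by
  have hT := h.isSimple
  have hR := removes_kill hT hK
  have hl := hK.1
  have hbest := greedy_move_isBest (k := k) (T := T) (x := x) hR.isSimple
  rw [transport_kill hK] at hbest
  obtain ⟨hx', hx'l⟩ := (hR.mem_configs hl).1 hbest.1
  refine ⟨hR.isSimple, hbest.1, hbest.strictlyStable hR.isSimple fun z hz => ?_, fun y hy => ?_,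
    hR.attracts hl h.attracts⟩
  · obtain ⟨hzT, hzl⟩ := (hR.mem_configs hl).1 hz
    rw [hR.OT_eq k _ _ hx' hx'l hzT hzl]
    exact hT.OT_triangle _ _ _
  · obtain ⟨hyT, hyl⟩ := (hR.mem_configs hl).1 hy
    obtain ⟨w, hw, hwl, z, hz, -, hwx⟩ :=
      hT.exists_evacuation hk h.config hyT hl hyl (h.attracts l hl)
    have h1 := hbest.le ((hR.mem_configs hl).2 ⟨hw, hwl⟩)
    rw [hR.potential_eq k _ _ (phi_zero k) hw hwl] at h1
    rw [hR.potential_eq k _ y (phi_zero k) hyT hyl]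
    have h2 := h.bound z hz
    linarith

theorem Invariant.of_reach (hk : 2 ≤ k) {c : ℝ} (h : (greedy k).Reach T x c) :
    Invariant k T x c := by
  induction h with
  | start T l hT hl => exact Invariant.start hk hT hl
  | wait T x c _ ih => exact ih.wait
  | elongate T x c l s _ hE hs hq ih => exact ih.elongate hk hE hs hq
  | fork T x c l S _ hF ih =>
    exact ih.fork hk hF ((greedy k).forkLength_pos _ _ _ _)
      (greedy_smallLength ih.isSimple ih.strict _ _)
  | kill T x c l _ hK ih => exact ih.kill hk hK

/-! ### Legality and the final bound -/

/-- Every move made during the elongation of `l` removes a robot from `l`, so the number of moves is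
bounded by the number of robots there. -/
theorem greedy_sustains {l : ℕ} (hl0 : l ≠ 0) (n : ℕ) : ∀ (T : WTree) (x : ℕ → ℕ) (r : ℝ),
    T.IsSimpleTree → x ∈ T.configs k → T.StrictlyStable k x → l ∈ T.leaves → 0 ≤ r → x l ≤ n →
    (greedy k).Sustains l T x r := by
  induction n with
  | zero => exact fun T x r _ _ _ _ _ h => .blocked T x r (by omega)
  | succ n ih =>
    intro T x r hT hx hst hl hr hn
    by_cases hxl : x l ≤ 1
    · exact .blocked T x r hxl
    rcases hr.eq_or_lt with rfl | hr
    · exact .done T x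
    have hlv := (mem_leaves.1 hl).1
    -- The advantage of `z` after time `t` is `a z + t * b z`, negative at `t = 0` by strict
    -- stability. A move occurs at the first zero `-a z / b z` of one of these functions, if one
    -- becomes positive by time `r`.
    set a : (ℕ → ℕ) → ℝ := fun z => T.potential (phi k) x - (T.potential (phi k) z + T.OT x z)
      with ha
    set b : (ℕ → ℕ) → ℝ := fun z => phi k (x l) - (phi k (z l) + |(x l : ℝ) - z l|) with hb
    have hex : ∀ t z, (T.elongate l t).potential (phi k) x
        - ((T.elongate l t).potential (phi k) z + (T.elongate l t).OT x z) = a z + t * b z :=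
      fun t z => elongate_excess hT hl hl0 t z
    have haneg : ∀ z ∈ T.configs k, z ≠ x → a z < 0 := fun z hz hne => by
      have := hst z hz hne
      simp only [ha]
      linarith
    have hquiet : ∀ s : ℝ, (∀ t, 0 ≤ t → t < s → ∀ z ∈ T.configs k, z ≠ x → a z + t * b z < 0) →
        (greedy k).QuietUntil T x l s := fun s h t ht hts =>
      greedy_respond_eq_self (hT.elongate hlv hl0 ht) hx fun z hz hne => by
        have h1 := h t ht hts z hz hne
        rw [← hex] at h1
        linarith
    rcases Set.eq_empty_or_nonempty {z | z ∈ T.configs k ∧ z ≠ x ∧ 0 < a z + r * b z} with hB | hB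
    · refine .elongate T x r r (by omega) hr le_rfl (hquiet r fun t ht htr z hz hne => ?_) ?_
      · have h1 := haneg z hz hne
        have h2 : a z + r * b z ≤ 0 := by
          by_contra hcon
          exact Set.eq_empty_iff_forall_notMem.1 hB z ⟨hz, hne, not_le.1 hcon⟩
        rcases le_or_gt (b z) 0 with h3 | h3
        · nlinarith
        · nlinarith
      · rw [sub_self]
        exact .done _ _
    · obtain ⟨z₀, ⟨hz₀, hne₀, hpos₀⟩, hmin⟩ := Set.exists_min_image _ (fun z => -a z / b z)
        ((T.configs_finite k).subset fun _ h => h.1) hB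
      have hbpos : ∀ z ∈ T.configs k, z ≠ x → 0 < a z + r * b z → 0 < b z := by
        intro z hz hne h
        have := haneg z hz hne
        by_contra hcon
        nlinarith
      have hb₀ := hbpos z₀ hz₀ hne₀ hpos₀
      have ha₀ := haneg z₀ hz₀ hne₀
      obtain ⟨s, hs⟩ : ∃ s, s = -a z₀ / b z₀ := ⟨_, rfl⟩
      have hsb : a z₀ + s * b z₀ = 0 := by rw [hs]; field_simp; ring
      have hs0 : 0 < s := by rw [hs]; exact div_pos (by linarith) hb₀
      have hsr : s < r := by
        rw [hs, div_lt_iff₀ hb₀]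
        linarith
      have hT' := hT.elongate hlv hl0 hs0.le
      have hbest := greedy_respond_isBest (k := k) (x := x) hT'
      have hstr := greedy_respond_strictlyStable (k := k) (x := x) hT'
      refine .elongate T x r s (by omega) hs0 hsr.le (hquiet s fun t ht hts z hz hne => ?_)
        (ih _ _ _ hT' hbest.1 hstr hl (by linarith) ?_)
      · have h1 := haneg z hz hne
        by_cases hzB : 0 < a z + r * b z
        · have h2 := hbpos z hz hne hzB
          have h3 : s ≤ -a z / b z := hs ▸ hmin z ⟨hz, hne, hzB⟩
          rw [le_div_iff₀ h2] at h3
          nlinarith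
        · rcases le_or_gt (b z) 0 with h3 | h3
          · nlinarith
          · nlinarith
      -- At time `s` the configuration `z₀` ties with `x`, so a strictly stable response cannot be
      -- `x`.
      · have hmove : (greedy k).respond (T.elongate l s) x ≠ x := by
          intro heq
          rw [heq] at hstr
          have h1 := hstr z₀ hz₀ hne₀
          have h2 := hex s z₀
          linarith
        set x' := (greedy k).respond (T.elongate l s) x
        have h1 := hbest.le (z := x) hx
        rw [OT_self, add_zero] at h1
        have h2 := hex s x'
        have h3 := haneg x' hbest.1 hmove
        -- The advantage of `x'` has risen from negative to nonnegative, so its rate is positive; by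
        -- monotonicity of `φ` this means fewer robots on `l`.
        have h4 : 0 < b x' := by
          by_contra hcon
          nlinarith
        by_contra hcon
        have h5 := phi_mono k (show x l ≤ x' l by omega)
        have h6 := abs_nonneg ((x l : ℝ) - x' l)
        simp only [hb] at h4
        linarith

theorem greedy_isLegal (hk : 2 ≤ k) : (greedy k).IsLegal where
  fork_keeps := by
    intro T x c l S hR hF u hu hul
    have h := Invariant.of_reach hk hR
    exact greedy_fork_keeps hk h.isSimple h.config hF ((greedy k).forkLength_pos _ _ _ _)
      (greedy_smallLength h.isSimple h.strict _ _) hu hul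
  sustains := by
    intro T x c l r hR hE hr
    have h := Invariant.of_reach hk hR
    exact greedy_sustains hE.2.1 (x l) T x r h.isSimple h.config h.strict hE.1 hr.le le_rfl

open Classical in
theorem mass_single {v : ℕ} (hv : v ∈ T.verts) {u : ℕ} :
    T.mass (Pi.single v k) u = if T.Desc v u then k else 0 := by
  unfold mass
  split_ifs with h
  · rw [Finset.sum_eq_single v (fun b _ hne => Pi.single_eq_of_ne hne _)
      (fun h' => absurd (Finset.mem_filter.2 ⟨hv, h⟩) h'), Pi.single_eq_same]
  · refine Finset.sum_eq_zero fun b hb => Pi.single_eq_of_ne ?_ _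
    rintro rfl
    exact h (Finset.mem_filter.1 hb).2

theorem potential_single {v : ℕ} (hv : v ∈ T.verts) :
    T.potential (phi k) (Pi.single v k) = phi k k * T.depth v := by
  classical
  unfold potential depth
  rw [Finset.mul_sum, Finset.sum_filter]
  refine Finset.sum_congr rfl fun u _ => ?_
  rw [mass_single hv]
  split_ifs
  · ring
  · rw [phi_zero, mul_zero]

theorem WTree.IsSimpleTree.exists_highest_leaf (hT : T.IsSimpleTree) :
    ∃ v ∈ T.leaves, T.depth v = T.highestLeafDepth := by
  have hne : (T.depth '' (T.leaves : Set ℕ)).Nonempty := by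
    obtain ⟨l, hl⟩ := hT.leaves_nonempty
    exact ⟨_, l, hl, rfl⟩
  obtain ⟨v, hv, h⟩ := hne.csInf_mem (T.leaves.finite_toSet.image _)
  exact ⟨v, hv, h⟩

theorem greedy_cost_le (hk : 2 ≤ k) {c : ℝ} (hR : (greedy k).Reach T x c) :
    c ≤ 525 * (k : ℝ) ^ 2 * T.highestLeafDepth := by
  have h := Invariant.of_reach hk hR
  obtain ⟨v, hv, hd⟩ := h.isSimple.exists_highest_leaf
  -- All robots on the highest leaf have potential `25 k² D`, and `21 * 25 = 525`.
  have h1 := h.bound _ (single_mem_configs hv k)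
  have h2 := h.isSimple.potential_nonneg (k := k) x
  rw [potential_single (mem_leaves.1 hv).1, hd] at h1
  simp only [phi] at h1 h2
  linarith

end Game
end CTM

theorem mainTheorem3 :
    ∃ f : ℕ → ℝ → ℝ,
      (∃ C : ℝ, ∀ k : ℕ, 2 ≤ k → ∀ D : ℝ, 0 ≤ D → |f k D| ≤ C * (k : ℝ) ^ 2 * D) ∧
      ∀ k : ℕ, 2 ≤ k → ∃ A : CTM.Strategy k,
        A.IsGreedy (fun y : ℝ => 20 * (k : ℝ) * y + 5 * y ^ 2) ∧ A.IsBounded f := by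
  refine ⟨fun k D => 525 * (k : ℝ) ^ 2 * D, ⟨525, fun k _ D hD => ?_⟩, fun k hk =>
    ⟨CTM.greedy k, CTM.greedy_isGreedy k, CTM.greedy_isLegal hk,
      fun T x c hR => CTM.greedy_cost_le hk hR⟩⟩
  rw [abs_of_nonneg (by positivity)]
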